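/- Let $(\bar M,\bar h)$ be a smooth $3$-dimensional Riemannian manifold and $\mathscr K$ a smooth $(1,1)$-tensor field on $\bar M$ which is symmetric with respect to $\bar h$ and has three distinct eigenvalues $p_1<p_2<p_3$. Let $(V,\bar{\mathsf x})$ be local coordinates on $\bar M$, assume that $\mathrm{tr}\,\mathscr K=1$ on $V$, and assume that there are smooth functions $X_1^2,X_1^3,X_2^3$ on $V$ such that the frame $$X_3=\partial_3,\qquad X_2=\partial_2+X_2^3\partial_3,\qquad X_1=\partial_1+X_1^2\partial_2+X_1^3\partial_3$$ satisfies $\mathscr K X_A=p_AX_A$ on $V$ (no summation). Let $$Y^1=d\bar{\mathsf x}^1,\quad Y^2=d\bar{\mathsf x}^2-X_1^2\,d\bar{\mathsf x}^1,\quad Y^3=d\bar{\mathsf x}^3-X_2^3\,d\bar{\mathsf x}^2+(X_1^2X_2^3-X_1^3)\,d\bar{\mathsf x}^1$$ be the dual coframe. With $\mathscr K\partial_i=\sum_j\mathscr K_i^{\ j}\partial_j$, define $c_{ij}=c_{ji}$ on $V$ by $c_{AA}=\bar h(X_A,X_A)$ and $$c_{12}=\frac{c_{22}}{p_2-p_1}\mathscr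 K_1^{\ 2},\quad c_{23}=\frac{c_{33}}{p_3-p_2}\mathscr K_2^{\ 3},\quad c_{13}=\frac{c_{33}}{p_3-p_1}\Big(\mathscr K_1^{\ 3}+\frac{1}{p_3-p_2}\mathscr K_1^{\ 2}\mathscr K_2^{\ 3}\Big),$$ and $\kappa_i^{\ j}$ by $\kappa_i^{\ i}=-p_i$, $\kappa_i^{\ j}=0$ for $j<i$, and $$\kappa_1^{\ 2}=(p_1-p_2)\frac{c_{12}}{c_{22}},\quad \kappa_2^{\ 3}=(p_2-p_3)\frac{c_{23}}{c_{33}},\quad \kappa_1^{\ 3}=(p_2-p_1)\frac{c_{12}c_{23}}{c_{22}c_{33}}+(p_1-p_3)\frac{c_{13}}{c_{33}}.$$ Let $t_0>0$ and let $$g=-dt\otimes dt+\sum_{i,j=1}^3a_{ij}\,t^{2p_{\max\{i,j\}}}\,d\bar{\mathsf x}^i\otimes d\bar{\mathsf x}^j$$ be a Lorentz metric on $V\times(0,t_0]$, with smooth $a_{ij}=a_{ji}$ and Riemannian induced metrics $\bar g$ on the leaves $V\times\{t\}$, solving Einstein's vacuum equations $\mathrm{Ric}=0$. Let $\bar k=\frac12\partial_t\bar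 g$ be the second fundamental form, $\bar K$ (with components $\bar K_j^{\ i}=\bar k_j^{\ i}$) the Weingarten map and $\theta=\mathrm{tr}\,\bar K$ the mean curvature of the leaves, and $\mathcal K=\bar K/\theta$ (defined where $\theta\neq0$) the expansion normalised Weingarten map. Let $W\subset\bar M$ have compact closure contained in $V$, and let $\varepsilon>0$. The $C^l(W)$-norms below are those of the components with respect to the coordinates $\bar{\mathsf x}$. Then there are smooth functions $b_{AB}=b_{BA}$ on $V\times(0,t_0]$ such that $$g=-dt\otimes dt+\sum_{A,B=1}^3b_{AB}\,t^{2p_{\max\{A,B\}}}\,Y^A\otimes Y^B\qquad\text{on }V\times(0,t_0].$$ Moreover, with $\check h=\sum_{A,B}b_{AB}Y^A\otimes Y^B$, there is an $\eta>0$ such that the following holds for every $l\in\{0,1,2,\dots\}$ for which there is a constant $C_l$ with $$\|a_{ij}(\cdot,t)-c_{ij}\|_{C^l(W)}\le C_lt^\varepsilon,\qquad \|t\bar k_i^{\ j}(\cdot,t)+\kappa_i^{\ j}\|_{C^l(W)}\le C_lt^\varepsilon$$ for all $t\in(0,t_0]$ and all $i,j$: 1. There is a constant $C$ with $\|\check h(\cdot,t)-\bar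 h\|_{C^l(W)}\le Ct^\eta$ for all $t\in(0,t_0]$. 2. There are $t_1\in(0,t_0]$ and a constant $C$ such that, for all $t\in(0,t_1]$, $\theta(\cdot,t)>0$ on $W$ and $\|\mathcal K(\cdot,t)-\mathscr K\|_{C^l(W)}\le Ct^\eta$. 3. If $\theta$ has no zero on $\overline W\times(0,t_0]$, there is a constant $C$ with $\|\mathcal K(\cdot,t)-\mathscr K\|_{C^l(W)}\le Ct^\eta$ for all $t\in(0,t_0]$. -/

import Mathlib

open scoped Manifold ContDiff Bundle

namespace BigBang

/-- The model space of a `3`-dimensional manifold. -/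
abbrev E3 : Type := EuclideanSpace ℝ (Fin 3)

noncomputable section

/-! ### Coordinate frames, the triangular frame and its dual -/

section Frames

variable {M : Type*} [TopologicalSpace M] [ChartedSpace E3 M]

/-- The coordinate vector field `∂ᵢ` of the chart `φ`. -/
def coordVF (φ : OpenPartialHomeomorph M E3) (i : Fin 3) (x : M) : TangentSpace (𝓡 3) x :=
  let v : E3 := mfderiv 𝓘(ℝ, E3) (𝓡 3) φ.symm (φ x) (EuclideanSpace.single i (1 : ℝ) : E3)
  v

/-- The coordinate one-form `dxⁱ` of the chart `φ`. -/
def coordForm (φ : OpenPartialHomeomorph M E3) (i : Fin 3) (x : M)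
    (v : TangentSpace (𝓡 3) x) : ℝ :=
  let w : E3 := mfderiv (𝓡 3) 𝓘(ℝ, E3) φ x v
  w i

/-- The triangular frame
`X₁ = ∂₁ + X₁² ∂₂ + X₁³ ∂₃`, `X₂ = ∂₂ + X₂³ ∂₃`, `X₃ = ∂₃`
with coefficients `X12 = X₁²`, `X13 = X₁³`, `X23 = X₂³`
(the indices `1, 2, 3` are the elements `0, 1, 2` of `Fin 3`). -/
def triFrame (φ : OpenPartialHomeomorph M E3) (X12 X13 X23 : M → ℝ) (A : Fin 3) (x : M) :
    TangentSpace (𝓡 3) x :=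
  ![coordVF φ 0 x + X12 x • coordVF φ 1 x + X13 x • coordVF φ 2 x,
    coordVF φ 1 x + X23 x • coordVF φ 2 x,
    coordVF φ 2 x] A

/-- The coframe dual to `triFrame`:
`Y¹ = dx¹`, `Y² = dx² - X₁² dx¹`, `Y³ = dx³ - X₂³ dx² + (X₁² X₂³ - X₁³) dx¹`. -/
def triCoframe (φ : OpenPartialHomeomorph M E3) (X12 X13 X23 : M → ℝ) (A : Fin 3) (x : M)
    (v : TangentSpace (𝓡 3) x) : ℝ :=
  ![coordForm φ 0 x v,
    coordForm φ 1 x v - X12 x * coordForm φ 0 x v,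
    coordForm φ 2 x v - X23 x * coordForm φ 1 x v
      + (X12 x * X23 x - X13 x) * coordForm φ 0 x v] A

theorem coordForm_coordVF [IsManifold (𝓡 3) ∞ M] {φ : OpenPartialHomeomorph M E3}
    (hφ : φ ∈ IsManifold.maximalAtlas (𝓡 3) ∞ M) {x : M} (hx : x ∈ φ.source) (i j : Fin 3) :
    coordForm φ i x (coordVF φ j x) = if i = j then 1 else 0 := by
  have h1 : φ.MDifferentiable (𝓡 3) 𝓘(ℝ, E3) :=
    ⟨(contMDiffOn_of_mem_maximalAtlas hφ).mdifferentiableOn (by simp),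
      (contMDiffOn_symm_of_mem_maximalAtlas hφ).mdifferentiableOn (by simp)⟩
  have h2 := h1.comp_symm_deriv (φ.map_source hx)
  rw [φ.left_inv hx] at h2
  have h3 := congrArg (fun L : E3 →L[ℝ] E3 => (L (EuclideanSpace.single j (1 : ℝ))) i) h2
  have h4 : coordForm φ i x (coordVF φ j x) = (EuclideanSpace.single j (1 : ℝ) : E3) i := h3
  rw [h4]
  simp

theorem triCoframe_triFrame [IsManifold (𝓡 3) ∞ M] {φ : OpenPartialHomeomorph M E3}
    (hφ : φ ∈ IsManifold.maximalAtlas (𝓡 3) ∞ M) {x : M} (hx : x ∈ φ.source)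
    (X12 X13 X23 : M → ℝ) (A B : Fin 3) :
    triCoframe φ X12 X13 X23 A x (triFrame φ X12 X13 X23 B x) = if A = B then 1 else 0 := by
  have add : ∀ i (v w : TangentSpace (𝓡 3) x),
      coordForm φ i x (v + w) = coordForm φ i x v + coordForm φ i x w := by
    intro i v w
    simp only [coordForm, map_add]
    rfl
  have smul : ∀ i (r : ℝ) (v : TangentSpace (𝓡 3) x),
      coordForm φ i x (r • v) = r * coordForm φ i x v := by
    intro i r v
    simp only [coordForm, map_smul]
    rfl
  fin_cases A <;> fin_cases B <;>
    simp [triCoframe, triFrame, add, smul, coordForm_coordVF hφ hx] <;> ring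

end Frames

/-! ### The limit data `cᵢⱼ` and `κᵢʲ` -/

section Data

variable {M : Type*} [TopologicalSpace M] [ChartedSpace E3 M]

/-- The component `𝒦ᵢʲ` of a `(1,1)`-tensor field: `𝒦 ∂ᵢ = ∑ⱼ 𝒦ᵢʲ ∂ⱼ`. -/
def comp11 (φ : OpenPartialHomeomorph M E3)
    (K : ∀ x : M, TangentSpace (𝓡 3) x →L[ℝ] TangentSpace (𝓡 3) x) (i j : Fin 3) (x : M) : ℝ :=
  coordForm φ j x (K x (coordVF φ i x))

/-- The component `T(∂ᵢ, ∂ⱼ)` of a covariant `2`-tensor field. -/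
def comp02 (φ : OpenPartialHomeomorph M E3)
    (T : ∀ x : M, TangentSpace (𝓡 3) x → TangentSpace (𝓡 3) x → ℝ) (i j : Fin 3) (x : M) : ℝ :=
  T x (coordVF φ i x) (coordVF φ j x)

/-- The functions `cᵢⱼ = cⱼᵢ` determined by `(h, 𝒦)` and the triangular frame:
`c_AA = h(X_A, X_A)`, `c₁₂ = c₂₂ 𝒦₁² / (p₂ - p₁)`, `c₂₃ = c₃₃ 𝒦₂³ / (p₃ - p₂)`,
`c₁₃ = c₃₃ (𝒦₁³ + 𝒦₁² 𝒦₂³ / (p₃ - p₂)) / (p₃ - p₁)`. -/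
def limitC (φ : OpenPartialHomeomorph M E3)
    (h : ∀ x : M, TangentSpace (𝓡 3) x → TangentSpace (𝓡 3) x → ℝ)
    (K : ∀ x : M, TangentSpace (𝓡 3) x →L[ℝ] TangentSpace (𝓡 3) x) (p : Fin 3 → M → ℝ)
    (X12 X13 X23 : M → ℝ) (i j : Fin 3) (x : M) : ℝ :=
  let d : Fin 3 → ℝ := fun A => h x (triFrame φ X12 X13 X23 A x) (triFrame φ X12 X13 X23 A x)
  let c12 : ℝ := d 1 / (p 1 x - p 0 x) * comp11 φ K 0 1 x
  let c23 : ℝ := d 2 / (p 2 x - p 1 x) * comp11 φ K 1 2 x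
  let c13 : ℝ := d 2 / (p 2 x - p 0 x) *
    (comp11 φ K 0 2 x + 1 / (p 2 x - p 1 x) * comp11 φ K 0 1 x * comp11 φ K 1 2 x)
  !![d 0, c12, c13; c12, d 1, c23; c13, c23, d 2] i j

/-- The functions `κᵢʲ` determined by `pᵢ` and `cᵢⱼ`; the entry `(i, j)` is `κᵢʲ`:
`κᵢⁱ = -pᵢ`, `κᵢʲ = 0` for `j < i`, `κ₁² = (p₁ - p₂) c₁₂ / c₂₂`, `κ₂³ = (p₂ - p₃) c₂₃ / c₃₃`,
`κ₁³ = (p₂ - p₁) c₁₂ c₂₃ / (c₂₂ c₃₃) + (p₁ - p₃) c₁₃ / c₃₃`. -/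
def kappa (p : Fin 3 → M → ℝ) (c : Fin 3 → Fin 3 → M → ℝ) (i j : Fin 3) (x : M) : ℝ :=
  !![-p 0 x, (p 0 x - p 1 x) * (c 0 1 x / c 1 1 x),
      (p 1 x - p 0 x) * (c 0 1 x * c 1 2 x / (c 1 1 x * c 2 2 x))
        + (p 0 x - p 2 x) * (c 0 2 x / c 2 2 x);
    0, -p 1 x, (p 1 x - p 2 x) * (c 1 2 x / c 2 2 x);
    0, 0, -p 2 x] i j

end Data

/-! ### `C^l` norms over a subset of a chart domain -/

section Norms

variable {M : Type*} [TopologicalSpace M]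

/-- The `C^l(W)` norm, in the coordinates `φ`, of a function `f`:
the sum over `m ≤ l` of the suprema over `W` of the `m`-th coordinate derivatives. -/
def clNorm (φ : OpenPartialHomeomorph M E3) (l : ℕ) (W : Set M) (f : M → ℝ) : ENNReal :=
  ∑ m ∈ Finset.range (l + 1), ⨆ x ∈ W, ‖iteratedFDeriv ℝ m (f ∘ φ.symm) (φ x)‖ₑ

/-- The `C^l(W)` norm, in the coordinates `φ`, of a tensor field of rank two with components
`T i j`. -/
def clTensorNorm (φ : OpenPartialHomeomorph M E3) (l : ℕ) (W : Set M)
    (T : Fin 3 → Fin 3 → M → ℝ) : ENNReal :=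
  ∑ i, ∑ j, clNorm φ l W (T i j)

end Norms

/-! ### Ricci curvature in coordinates -/

section Curvature

variable {n : ℕ}

/-- The partial derivative `∂_μ f` at `y`. -/
def pderiv (μ : Fin n) (f : (Fin n → ℝ) → ℝ) (y : Fin n → ℝ) : ℝ :=
  fderiv ℝ f y (Pi.single μ 1)

/-- The Christoffel symbol `Γ^ρ_{μν}` of the metric with components `G`. -/
def christoffel (G : (Fin n → ℝ) → Matrix (Fin n) (Fin n) ℝ) (ρ μ ν : Fin n)
    (y : Fin n → ℝ) : ℝ :=
  (1 / 2) * ∑ σ, (G y)⁻¹ ρ σ *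
    (pderiv μ (fun z => G z σ ν) y + pderiv ν (fun z => G z σ μ) y
      - pderiv σ (fun z => G z μ ν) y)

/-- The component `Ric_{μν}` of the Ricci tensor of the metric with components `G`. -/
def ricci (G : (Fin n → ℝ) → Matrix (Fin n) (Fin n) ℝ) (μ ν : Fin n) (y : Fin n → ℝ) : ℝ :=
  ∑ ρ, (pderiv ρ (christoffel G ρ μ ν) y - pderiv ν (christoffel G ρ μ ρ) y)
    + ∑ ρ, ∑ σ, (christoffel G ρ ρ σ y * christoffel G σ μ ν y
      - christoffel G ρ ν σ y * christoffel G σ μ ρ y)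

end Curvature

/-! ### Gaussian metrics on `V × (0, t₀]` and their leaves -/

section Spacetime

variable {M : Type*} [TopologicalSpace M] [ChartedSpace E3 M]

/-- The metric `-dt ⊗ dt + ∑_{A,B} b_AB t^{2 p_max(A,B)} Y^A ⊗ Y^B` at the point `(x, t)`,
as a bilinear form on `T_x M × ℝ`. -/
def gaussMetric (Y : Fin 3 → ∀ x : M, TangentSpace (𝓡 3) x → ℝ) (p : Fin 3 → M → ℝ)
    (b : Fin 3 → Fin 3 → ℝ → M → ℝ) (t : ℝ) (x : M) (u w : TangentSpace (𝓡 3) x × ℝ) : ℝ :=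
  -(u.2 * w.2) + ∑ A, ∑ B, b A B t x * t ^ (2 * p (max A B) x) * (Y A x u.1 * Y B x w.1)

/-- The metric induced on the leaf `M × {t}` by a spacetime metric. -/
def inducedMetric (g : ℝ → ∀ x : M, TangentSpace (𝓡 3) x × ℝ → TangentSpace (𝓡 3) x × ℝ → ℝ)
    (t : ℝ) (x : M) (v w : TangentSpace (𝓡 3) x) : ℝ :=
  g t x (v, 0) (w, 0)

/-- The point of `M` with spatial coordinates `(y₁, y₂, y₃)`, for `y = (t, y₁, y₂, y₃)`. -/
def spatialPoint (φ : OpenPartialHomeomorph M E3) (y : Fin 4 → ℝ) : M :=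
  φ.symm (WithLp.toLp 2 fun i : Fin 3 => y i.succ)

/-- The coordinate frame `(∂_t, ∂₁, ∂₂, ∂₃)` on `V × ℝ`. -/
def spacetimeFrame (φ : OpenPartialHomeomorph M E3) (x : M) (μ : Fin 4) :
    TangentSpace (𝓡 3) x × ℝ :=
  Fin.cases (0, 1) (fun i : Fin 3 => (coordVF φ i x, 0)) μ

/-- The components of a spacetime metric in the coordinates `y = (t, y₁, y₂, y₃)`. -/
def spacetimeComponents (φ : OpenPartialHomeomorph M E3)
    (g : ℝ → ∀ x : M, TangentSpace (𝓡 3) x × ℝ → TangentSpace (𝓡 3) x × ℝ → ℝ)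
    (y : Fin 4 → ℝ) : Matrix (Fin 4) (Fin 4) ℝ :=
  Matrix.of fun μ ν => g (y 0) (spatialPoint φ y)
    (spacetimeFrame φ (spatialPoint φ y) μ) (spacetimeFrame φ (spatialPoint φ y) ν)

/-- `-dt ⊗ dt + ∑ᵢⱼ aᵢⱼ t^{2 p_max(i,j)} dxⁱ ⊗ dxʲ` is a smooth Lorentz metric on `V × (0, t₀]`
(`V` the domain of the chart `φ`) that solves Einstein's vacuum equations.
Smoothness at `t = t₀` is one-sided; the vacuum equations are imposed for `t < t₀`, which by
continuity is the same as imposing them for `t ≤ t₀`. -/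
structure IsVacuumSolution (φ : OpenPartialHomeomorph M E3) (p : Fin 3 → M → ℝ)
    (a : Fin 3 → Fin 3 → ℝ → M → ℝ) (t₀ : ℝ) : Prop where
  smooth : ∀ i j, ContMDiffOn ((𝓡 3).prod 𝓘(ℝ, ℝ)) 𝓘(ℝ, ℝ) ∞
    (fun q : M × ℝ => a i j q.2 q.1) (φ.source ×ˢ Set.Ioc 0 t₀)
  symm : ∀ i j, ∀ t ∈ Set.Ioc 0 t₀, ∀ x ∈ φ.source, a i j t x = a j i t x
  pos : ∀ t ∈ Set.Ioc 0 t₀, ∀ x ∈ φ.source, ∀ v : TangentSpace (𝓡 3) x, v ≠ 0 →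
    0 < inducedMetric (gaussMetric (coordForm φ) p a) t x v v
  vacuum : ∀ y : Fin 4 → ℝ, y 0 ∈ Set.Ioo 0 t₀ →
    WithLp.toLp 2 (fun i : Fin 3 => y i.succ) ∈ φ.target →
    ∀ μ ν, ricci (spacetimeComponents φ (gaussMetric (coordForm φ) p a)) μ ν y = 0

/-- The second fundamental form `k_t = (1/2) ∂_t g_t` of the leaves of a Gaussian foliation with
induced metrics `g_t`, `t ∈ J` (with respect to the unit normal `∂_t`). -/
def secondFundForm (J : Set ℝ)
    (gbar : ℝ → ∀ x : M, TangentSpace (𝓡 3) x → TangentSpace (𝓡 3) x → ℝ)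
    (t : ℝ) (x : M) (v w : TangentSpace (𝓡 3) x) : ℝ :=
  (1 / 2) * derivWithin (fun s => gbar s x v w) J t

/-- The component `K_iʲ = k_iʲ = ∑ₗ g^{jl} k_{li}` of the Weingarten map of the leaves. -/
def weingarten (φ : OpenPartialHomeomorph M E3) (J : Set ℝ)
    (gbar : ℝ → ∀ x : M, TangentSpace (𝓡 3) x → TangentSpace (𝓡 3) x → ℝ)
    (i j : Fin 3) (t : ℝ) (x : M) : ℝ :=
  ∑ l, (Matrix.of fun r s => comp02 φ (gbar t) r s x)⁻¹ j l *
    comp02 φ (secondFundForm J gbar t) l i x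

/-- The mean curvature `θ` of the leaves: the trace of the Weingarten map. -/
def meanCurvature (φ : OpenPartialHomeomorph M E3) (J : Set ℝ)
    (gbar : ℝ → ∀ x : M, TangentSpace (𝓡 3) x → TangentSpace (𝓡 3) x → ℝ)
    (t : ℝ) (x : M) : ℝ :=
  ∑ i, weingarten φ J gbar i i t x

/-- The component `(K / θ)_iʲ` of the expansion normalised Weingarten map
(meaningful where `θ ≠ 0`). -/
def expNormWeingarten (φ : OpenPartialHomeomorph M E3) (J : Set ℝ)
    (gbar : ℝ → ∀ x : M, TangentSpace (𝓡 3) x → TangentSpace (𝓡 3) x → ℝ)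
    (i j : Fin 3) (t : ℝ) (x : M) : ℝ :=
  weingarten φ J gbar i j t x / meanCurvature φ J gbar t x

/-- The tensor field `∑_{A,B} b_AB Y^A ⊗ Y^B` on the leaf `M × {t}`. -/
def hCheck (Y : Fin 3 → ∀ x : M, TangentSpace (𝓡 3) x → ℝ) (b : Fin 3 → Fin 3 → ℝ → M → ℝ)
    (t : ℝ) (x : M) (v w : TangentSpace (𝓡 3) x) : ℝ :=
  ∑ A, ∑ B, b A B t x * (Y A x v * Y B x w)

end Spacetime

end

end BigBang

open BigBang

/-! Substituting `dxⁱ = ∑_A X_Aⁱ Y^A` in the metric forces `b_AB = ∑ aᵢⱼ t^{2 p_max(i,j) - 2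
p_max(A,B)} X_Aⁱ X_Bʲ`. A negative exponent would be fatal, but it can only occur if `max(i,j) <
max(A,B)`, and then `X_Aⁱ X_Bʲ = 0` because the frame is triangular (`frameMatrix_mul_eq_zero`).
Terms with `max(i,j) > max(A,B)` decay, since the eigenvalue gaps are at least some `δ > 0` on the
compact closure of `W`. Hence `b_AB` tends to the sum of `cᵢⱼ X_Aⁱ X_Bʲ` over `max(i,j) = max(A,B)`.
The definition of `cᵢⱼ` makes this sum `c_AA` if `A = B` and `0` otherwise
(`sum_limitC_frameMatrix`). These are also the components of `h`, whose eigenframe is orthogonal by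
the symmetry of `𝒦` (`comp02_eq_sum`).

For the Weingarten map, unwinding the definitions gives `κᵢʲ = -𝒦ᵢʲ` (`kappa_limitC_eq`), so the
hypothesis says that `t K̄` tends to `𝒦`. Taking traces, `t θ` tends to `tr 𝒦 = 1`, and the quotient
converges wherever `t θ` stays away from zero (`unifCl_div_sub`).

In `C^l`, spatial derivatives of `t^{q(x)}` produce powers of `log t`. The exponents are at least
`2δ`, so one `δ` absorbs the logarithms and the rate `η = min(ε, δ)` remains, independently of `l`.
This bookkeeping is done by the predicate `UnifCl`, which is stable under sums, products and
inverses. -/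

namespace BigBang

/-! ### Calculus of `C^l` bounds that are uniform in time -/

section UniformBounds

variable {E : Type*} [NormedAddCommGroup E] [NormedSpace ℝ E]

/-- Smoothness at a point provides a neighbourhood for each finite order, which may shrink as the
order grows; hence `n` is fixed first. -/
theorem exists_isOpen_contDiffOn {f : E → ℝ} {x : E} (hf : ContDiffAt ℝ ∞ f x) (n : ℕ) :
    ∃ u, IsOpen u ∧ x ∈ u ∧ ContDiffOn ℝ n f u := by
  obtain ⟨u, hu, hfu⟩ := (hf.of_le (m := (n : ℕ∞ω)) (by exact_mod_cast le_top)).contDiffOn le_rfl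
    (by simp)
  obtain ⟨v, hvu, hv, hxv⟩ := mem_nhds_iff.1 hu
  exact ⟨v, hv, hxv, hfu.mono hvu⟩

theorem norm_iteratedFDeriv_mul_le_of_contDiffAt {f g : E → ℝ} {x : E}
    (hf : ContDiffAt ℝ ∞ f x) (hg : ContDiffAt ℝ ∞ g x) (n : ℕ) :
    ‖iteratedFDeriv ℝ n (fun y => f y * g y) x‖ ≤ ∑ i ∈ Finset.range (n + 1),
      (n.choose i : ℝ) * ‖iteratedFDeriv ℝ i f x‖ * ‖iteratedFDeriv ℝ (n - i) g x‖ := by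
  obtain ⟨u, hu, hxu, hfu⟩ := exists_isOpen_contDiffOn hf n
  obtain ⟨v, hv, hxv, hgv⟩ := exists_isOpen_contDiffOn hg n
  have ho : IsOpen (u ∩ v) := hu.inter hv
  have hx : x ∈ u ∩ v := ⟨hxu, hxv⟩
  have h := norm_iteratedFDerivWithin_mul_le (hfu.mono Set.inter_subset_left)
    (hgv.mono Set.inter_subset_right) ho.uniqueDiffOn hx (n := n) le_rfl
  simpa only [iteratedFDerivWithin_of_isOpen _ ho hx] using h

/-- Faà di Bruno bound at a single point. It is applied to `z ↦ z⁻¹` and to `exp`. -/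
theorem norm_iteratedFDeriv_comp_le_of_contDiffAt {g : ℝ → ℝ} {s : Set ℝ} (hs : IsOpen s)
    (hg : ContDiffOn ℝ ∞ g s) {f : E → ℝ} {x : E} (hf : ContDiffAt ℝ ∞ f x) (hx : f x ∈ s)
    {n : ℕ} {C D : ℝ} (hC : ∀ i ≤ n, ‖iteratedFDeriv ℝ i g (f x)‖ ≤ C)
    (hD : ∀ i, 1 ≤ i → i ≤ n → ‖iteratedFDeriv ℝ i f x‖ ≤ D ^ i) :
    ‖iteratedFDeriv ℝ n (fun y => g (f y)) x‖ ≤ n.factorial * C * D ^ n := by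
  obtain ⟨u, hu, hxu, hfu⟩ := exists_isOpen_contDiffOn hf n
  have ho : IsOpen (u ∩ f ⁻¹' s) := hfu.continuousOn.isOpen_inter_preimage hu hs
  have hxo : x ∈ u ∩ f ⁻¹' s := ⟨hxu, hx⟩
  have h := norm_iteratedFDerivWithin_comp_le (n := n) (N := n) (C := C) (D := D) (x := x)
    (hg.of_le (by exact_mod_cast le_top))
    (hfu.mono (Set.inter_subset_left (t := f ⁻¹' s))) le_rfl hs.uniqueDiffOn ho.uniqueDiffOn
    (fun y hy => hy.2) hxo
    (fun i hi => by simpa only [iteratedFDerivWithin_of_isOpen i hs hx] using hC i hi)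
    (fun i h1 hi => by simpa only [iteratedFDerivWithin_of_isOpen i ho hxo] using hD i h1 hi)
  simpa only [iteratedFDerivWithin_of_isOpen n ho hxo, Function.comp_def] using h

/-- The functions `f t`, `t ∈ T`, are smooth at the points of `S`, and their derivatives of order
at most `l` are `O(w t)` there, uniformly in `t ∈ T`. -/
structure UnifCl (T : Set ℝ) (S : Set E) (l : ℕ) (w : ℝ → ℝ) (f : ℝ → E → ℝ) : Prop where
  smooth : ∀ t ∈ T, ∀ y ∈ S, ContDiffAt ℝ ∞ (f t) y
  bound : ∃ C, 0 ≤ C ∧ ∀ t ∈ T, ∀ y ∈ S, ∀ m ≤ l, ‖iteratedFDeriv ℝ m (f t) y‖ ≤ C * w t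

namespace UnifCl

variable {T : Set ℝ} {S : Set E} {l : ℕ} {w w' : ℝ → ℝ} {f g : ℝ → E → ℝ}

theorem mono_weight (hf : UnifCl T S l w f) {k : ℝ} (hk : 0 ≤ k)
    (h : ∀ t ∈ T, w t ≤ k * w' t) : UnifCl T S l w' f := by
  obtain ⟨C, hC, hb⟩ := hf.bound
  refine ⟨hf.smooth, C * k, by positivity, fun t ht y hy m hm => (hb t ht y hy m hm).trans ?_⟩
  rw [mul_assoc]
  exact mul_le_mul_of_nonneg_left (h t ht) hC

theorem mono_set (hf : UnifCl T S l w f) {T' : Set ℝ} (h : T' ⊆ T) : UnifCl T' S l w f := by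
  obtain ⟨C, hC, hb⟩ := hf.bound
  exact ⟨fun t ht => hf.smooth t (h ht), C, hC, fun t ht => hb t (h ht)⟩

theorem congr_eventuallyEq (hf : UnifCl T S l w f)
    (he : ∀ t ∈ T, ∀ y ∈ S, g t =ᶠ[nhds y] f t) : UnifCl T S l w g := by
  obtain ⟨C, hC, hb⟩ := hf.bound
  refine ⟨fun t ht y hy => (hf.smooth t ht y hy).congr_of_eventuallyEq (he t ht y hy), C, hC,
    fun t ht y hy m hm => ?_⟩
  rw [((he t ht y hy).iteratedFDeriv ℝ m).eq_of_nhds]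
  exact hb t ht y hy m hm

theorem congr (hf : UnifCl T S l w f) {U : Set E} (hU : IsOpen U) (hS : S ⊆ U)
    (h : ∀ t ∈ T, ∀ y ∈ U, g t y = f t y) : UnifCl T S l w g :=
  hf.congr_eventuallyEq fun t ht _ hy => Filter.eventually_of_mem (hU.mem_nhds (hS hy)) (h t ht)

theorem exists_abs_le (hf : UnifCl T S l w f) :
    ∃ C, 0 ≤ C ∧ ∀ t ∈ T, ∀ y ∈ S, |f t y| ≤ C * w t := by
  obtain ⟨C, hC, hb⟩ := hf.bound
  exact ⟨C, hC, fun t ht y hy => by simpa using hb t ht y hy 0 (Nat.zero_le _)⟩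

theorem add (hf : UnifCl T S l w f) (hg : UnifCl T S l w g) :
    UnifCl T S l w (fun t y => f t y + g t y) := by
  obtain ⟨C, hC, hb⟩ := hf.bound
  obtain ⟨D, hD, hb'⟩ := hg.bound
  refine ⟨fun t ht y hy => (hf.smooth t ht y hy).add (hg.smooth t ht y hy), C + D, by positivity,
    fun t ht y hy m hm => ?_⟩
  have hm' : (m : ℕ∞ω) ≤ ∞ := by exact_mod_cast le_top
  rw [show (fun y => f t y + g t y) = f t + g t from rfl,
    iteratedFDeriv_add_apply ((hf.smooth t ht y hy).of_le hm') ((hg.smooth t ht y hy).of_le hm'), add_mul]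
  exact (norm_add_le _ _).trans (add_le_add (hb t ht y hy m hm) (hb' t ht y hy m hm))

theorem neg (hf : UnifCl T S l w f) : UnifCl T S l w (fun t y => -f t y) := by
  obtain ⟨C, hC, hb⟩ := hf.bound
  refine ⟨fun t ht y hy => (hf.smooth t ht y hy).neg, C, hC, fun t ht y hy m hm => ?_⟩
  rw [show (fun y => -f t y) = -f t from rfl, iteratedFDeriv_neg_apply, norm_neg]
  exact hb t ht y hy m hm

theorem sub (hf : UnifCl T S l w f) (hg : UnifCl T S l w g) :
    UnifCl T S l w (fun t y => f t y - g t y) := by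
  simpa only [sub_eq_add_neg] using hf.add hg.neg

theorem zero : UnifCl T S l w (fun _ _ => 0) := by
  refine ⟨fun t _ y _ => contDiffAt_const, 0, le_rfl, fun t ht y _ m _ => ?_⟩
  have : iteratedFDeriv ℝ m (fun _ : E => (0 : ℝ)) y = 0 := by
    rw [iteratedFDeriv_fun_zero]; rfl
  simp [this]

theorem sum {ι : Type*} (s : Finset ι) {F : ι → ℝ → E → ℝ}
    (h : ∀ i ∈ s, UnifCl T S l w (F i)) : UnifCl T S l w (fun t y => ∑ i ∈ s, F i t y) := by
  classical
  induction s using Finset.induction_on with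
  | empty => simpa using zero
  | insert i s hi ih =>
    simp only [Finset.sum_insert hi]
    exact (h i (by simp)).add (ih fun j hj => h j (by simp [hj]))

theorem mul (hf : UnifCl T S l w f) (hg : UnifCl T S l w' g) :
    UnifCl T S l (fun t => w t * w' t) (fun t y => f t y * g t y) := by
  obtain ⟨C, hC, hb⟩ := hf.bound
  obtain ⟨D, hD, hb'⟩ := hg.bound
  refine ⟨fun t ht y hy => (hf.smooth t ht y hy).mul (hg.smooth t ht y hy), 2 ^ l * (C * D),
    by positivity, fun t ht y hy m hm => ?_⟩
  refine (norm_iteratedFDeriv_mul_le_of_contDiffAt (hf.smooth t ht y hy)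
    (hg.smooth t ht y hy) m).trans ?_
  -- The weights carry no sign assumption; nonnegativity at this `t` is read off from the bounds of
  -- order zero.
  have hf0 := (norm_nonneg _).trans (hb t ht y hy 0 (Nat.zero_le _))
  have hg0 := (norm_nonneg _).trans (hb' t ht y hy 0 (Nat.zero_le _))
  calc _ ≤ ∑ i ∈ Finset.range (m + 1), (m.choose i : ℝ) * ((C * w t) * (D * w' t)) := by
        refine Finset.sum_le_sum fun i hi => ?_
        rw [mul_assoc]
        have hi' : i ≤ l := by have := Finset.mem_range.1 hi; omega
        gcongr
        · exact hb t ht y hy i hi'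
        · exact hb' t ht y hy (m - i) (by omega)
    _ = 2 ^ m * ((C * w t) * (D * w' t)) := by
        rw [← Finset.sum_mul]; congr 1; exact_mod_cast Nat.sum_range_choose m
    _ ≤ 2 ^ l * ((C * w t) * (D * w' t)) := by
        gcongr
        norm_num
    _ = _ := by ring

/-- The derivatives are continuous on `U`, hence bounded on the compact set `Z`, and time does not
enter. -/
theorem static {φ : E → ℝ} {U Z : Set E} (hU : IsOpen U) (hφ : ContDiffOn ℝ ∞ φ U)
    (hZ : IsCompact Z) (hZU : Z ⊆ U) (hS : S ⊆ Z) :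
    UnifCl T S l (fun _ => 1) (fun _ => φ) := by
  refine ⟨fun _ _ y hy => hφ.contDiffAt (hU.mem_nhds (hZU (hS hy))), ?_⟩
  have key : ∀ m : ℕ, ∃ C, ∀ y ∈ Z, ‖iteratedFDeriv ℝ m φ y‖ ≤ C := fun m => by
    refine hZ.exists_bound_of_continuousOn (f := iteratedFDeriv ℝ m φ) ?_
    have h : ContinuousOn (iteratedFDerivWithin ℝ m φ U) Z :=
      (hφ.continuousOn_iteratedFDerivWithin (by exact_mod_cast le_top) hU.uniqueDiffOn).mono hZU
    exact h.congr fun y hy => (iteratedFDerivWithin_of_isOpen m hU (hZU hy)).symm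
  choose C hC using key
  refine ⟨∑ m ∈ Finset.range (l + 1), |C m|, by positivity, fun t _ y hy m hm => ?_⟩
  rw [mul_one]
  exact ((hC m y (hS hy)).trans (le_abs_self _)).trans
    (Finset.single_le_sum (f := fun m => |C m|) (fun _ _ => abs_nonneg _)
      (Finset.mem_range.2 (by omega)))

theorem norm_iteratedFDeriv_le_pow {D : ℝ} (hD : 1 ≤ D) {f : E → ℝ} {x : E} {i : ℕ}
    (h : ‖iteratedFDeriv ℝ i f x‖ ≤ D) (hi : 1 ≤ i) : ‖iteratedFDeriv ℝ i f x‖ ≤ D ^ i :=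
  h.trans (le_self_pow₀ hD (by omega))

/-- On `|z| ≥ r` the `i`-th derivative of `z⁻¹` is at most `i! r⁻⁽ⁱ⁺¹⁾`, so the composition bound
applies. -/
theorem inv (hf : UnifCl T S l (fun _ => 1) f) {r : ℝ} (hr : 0 < r)
    (hfr : ∀ t ∈ T, ∀ y ∈ S, r ≤ |f t y|) :
    UnifCl T S l (fun _ => 1) (fun t y => (f t y)⁻¹) := by
  obtain ⟨D, hD, hb⟩ := hf.bound
  have hne : ∀ t ∈ T, ∀ y ∈ S, f t y ≠ 0 := fun t ht y hy h0 => by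
    have := hfr t ht y hy
    rw [h0, abs_zero] at this
    exact hr.not_ge this
  refine ⟨fun t ht y hy => (hf.smooth t ht y hy).inv (hne t ht y hy), ?_⟩
  have hk : ∀ i : ℕ, ∀ x : ℝ, r ≤ |x| →
      ‖iteratedFDeriv ℝ i (fun z : ℝ => z⁻¹) x‖ ≤ i.factorial * r⁻¹ ^ (i + 1) := by
    intro i x hx
    have hx0 : 0 < |x| := hr.trans_le hx
    rw [norm_iteratedFDeriv_eq_norm_iteratedDeriv, iteratedDeriv_eq_iterate, iter_deriv_inv]
    simp only [norm_mul, norm_pow, norm_neg, norm_one, one_pow, one_mul, Real.norm_eq_abs,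
      Nat.abs_cast]
    gcongr
    rw [show (-1 - (i : ℤ)) = -((i + 1 : ℕ) : ℤ) by push_cast; ring, zpow_neg, zpow_natCast,
      abs_inv, abs_pow, ← inv_pow]
    gcongr
  set C : ℝ := ∑ i ∈ Finset.range (l + 1), i.factorial * r⁻¹ ^ (i + 1) with hCdef
  have hC : 0 ≤ C := by positivity
  refine ⟨l.factorial * C * (D + 1) ^ l, by positivity, fun t ht y hy m hm => ?_⟩
  -- `D + 1 ≥ 1`, so a bound by `D + 1` implies the bound by `(D + 1) ^ i` that the composition
  -- estimate asks for.
  have h := norm_iteratedFDeriv_comp_le_of_contDiffAt (n := m) (C := C) (D := D + 1)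
    (g := fun z : ℝ => z⁻¹) (s := {z | z ≠ 0}) isOpen_ne
    (fun z hz => (contDiffAt_inv ℝ hz).contDiffWithinAt) (hf.smooth t ht y hy) (hne t ht y hy)
    (fun i hi => (hk i _ (hfr t ht y hy)).trans (Finset.single_le_sum
      (f := fun i : ℕ => (i.factorial : ℝ) * r⁻¹ ^ (i + 1))
      (fun _ _ => by positivity) (Finset.mem_range.2 (by omega))))
    (fun i h1 hi => norm_iteratedFDeriv_le_pow (by linarith)
      ((hb t ht y hy i (by omega)).trans (by linarith)) h1)
  refine h.trans ?_
  rw [mul_one]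
  gcongr
  linarith

theorem rpow_mul_one_add_abs_log_pow_bound {t₀ δ : ℝ} (hδ : 0 < δ) (n : ℕ) :
    ∃ C, 0 ≤ C ∧ ∀ t ∈ Set.Ioc 0 t₀, t ^ δ * (1 + |Real.log t|) ^ n ≤ C := by
  rcases Nat.eq_zero_or_pos n with rfl | hn
  · exact ⟨|t₀| ^ δ, by positivity, fun t ht => by
      simpa using Real.rpow_le_rpow ht.1.le (ht.2.trans (le_abs_self _)) hδ.le⟩
  -- With `s = δ / n` the expression is the `n`-th power of `t ^ s * (1 + |log t|)`; the logarithm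
  -- is controlled by `log u ≤ u ^ s / s` at `u = t` and `u = t⁻¹`.
  set s : ℝ := δ / n with hs
  have hn' : (0 : ℝ) < n := by exact_mod_cast hn
  have hs0 : 0 < s := by positivity
  refine ⟨(|t₀| ^ s + (|t₀| ^ (s + s) + 1) / s) ^ n, by positivity, fun t ht => ?_⟩
  have ht0 : 0 < t := ht.1
  have h1 : t ^ δ = (t ^ s) ^ n := by
    rw [← Real.rpow_natCast, ← Real.rpow_mul ht0.le, hs, div_mul_cancel₀ _ hn'.ne']
  rw [h1, ← mul_pow]
  have hlog : |Real.log t| ≤ (t ^ s + t ^ (-s)) / s := by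
    have a1 := Real.log_le_rpow_div ht0.le hs0
    have a2 := Real.log_le_rpow_div (inv_pos.2 ht0).le hs0
    rw [Real.log_inv, Real.inv_rpow ht0.le, ← Real.rpow_neg ht0.le] at a2
    have b1 : 0 ≤ t ^ s / s := by positivity
    have b2 : 0 ≤ t ^ (-s) / s := by positivity
    rw [add_div, abs_le]
    constructor <;> linarith
  have hle : t ≤ |t₀| := ht.2.trans (le_abs_self _)
  gcongr
  calc t ^ s * (1 + |Real.log t|) ≤ t ^ s * (1 + (t ^ s + t ^ (-s)) / s) := by gcongr
    _ = t ^ s + (t ^ (s + s) + 1) / s := by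
      have : t ^ s * t ^ (-s) = 1 := by rw [← Real.rpow_add ht0]; simp
      rw [Real.rpow_add ht0]
      field_simp
      linear_combination this
    _ ≤ _ := by gcongr

/-- Each derivative of `t ^ q = exp (q log t)` costs at most a factor `1 + |log t|`, up to
constants. The surplus `δ` of the exponent over `η` pays for them. -/
theorem rpow {t₀ : ℝ} {q : E → ℝ} {U Z : Set E} (hU : IsOpen U) (hq : ContDiffOn ℝ ∞ q U)
    (hZ : IsCompact Z) (hZU : Z ⊆ U) (hS : S ⊆ Z) {η δ : ℝ} (hδ : 0 < δ)
    (hqδ : ∀ y ∈ S, η + δ ≤ q y) :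
    UnifCl (Set.Ioc 0 t₀) S l (fun t => t ^ η) (fun t y => t ^ q y) := by
  have hst := static (T := Set.univ) (l := l) hU hq hZ hZU hS
  obtain ⟨D, hD, hb⟩ := hst.bound
  have hq' : ∀ y ∈ S, ContDiffAt ℝ ∞ q y := fun y hy => hst.smooth 0 trivial y hy
  have hqD : ∀ y ∈ S, |q y| ≤ D := fun y hy => by
    simpa using hb 0 trivial y hy 0 (Nat.zero_le _)
  obtain ⟨B, hB, hBt⟩ := rpow_mul_one_add_abs_log_pow_bound (t₀ := t₀) hδ l
  have hexp : ∀ t : ℝ, 0 < t → ∀ y, t ^ q y = Real.exp (Real.log t * q y) := fun t ht y =>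
    Real.rpow_def_of_pos ht _
  -- The power of `max 1 |t₀|` bounds `t ^ (q - (η + δ))`, whose exponent lies in `[0, D + |η +
  -- δ|]`; `B` bounds `t ^ δ` times the logarithms.
  refine ⟨fun t ht y hy => ?_, l.factorial * (max 1 |t₀| ^ (D + |η + δ|) * (B * (D + 1) ^ l)),
    by positivity, fun t ht y hy m hm => ?_⟩
  · have : (fun y => t ^ q y) = fun y => Real.exp (Real.log t * q y) := funext (hexp t ht.1)
    change ContDiffAt ℝ ∞ (fun y => t ^ q y) y
    rw [this]
    exact (contDiffAt_const.mul (hq' y hy)).exp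
  · have ht0 : 0 < t := ht.1
    have hfun : (fun y => t ^ q y) = fun y => Real.exp (Real.log t * q y) := funext (hexp t ht0)
    have hDt : 1 ≤ (D + 1) * (1 + |Real.log t|) := by
      nlinarith [abs_nonneg (Real.log t)]
    have h := norm_iteratedFDeriv_comp_le_of_contDiffAt (n := m) (C := t ^ q y)
      (D := (D + 1) * (1 + |Real.log t|)) (g := Real.exp) (s := Set.univ) isOpen_univ
      Real.contDiff_exp.contDiffOn (f := fun y => Real.log t * q y) (x := y)
      (contDiffAt_const.mul (hq' y hy)) trivial
      (fun i _ => by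
        rw [norm_iteratedFDeriv_eq_norm_iteratedDeriv, iteratedDeriv_eq_iterate,
          Real.iter_deriv_exp, Real.norm_eq_abs, Real.abs_exp, hexp t ht0])
      (fun i h1 hi => by
        refine norm_iteratedFDeriv_le_pow hDt ?_ h1
        have e : (fun y => Real.log t * q y) = Real.log t • q := rfl
        rw [e, iteratedFDeriv_const_smul_apply ((hq' y hy).of_le (by exact_mod_cast le_top)),
          norm_smul, Real.norm_eq_abs]
        have h2 := hb 0 trivial y hy i (by omega)
        rw [mul_one] at h2
        nlinarith [abs_nonneg (Real.log t), norm_nonneg (iteratedFDeriv ℝ i q y)])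
    rw [hfun]
    refine h.trans ?_
    have hsplit : t ^ q y = t ^ (q y - (η + δ)) * t ^ δ * t ^ η := by
      rw [← Real.rpow_add ht0, ← Real.rpow_add ht0]; congr 1; ring
    have h3 : t ^ (q y - (η + δ)) ≤ max 1 |t₀| ^ (D + |η + δ|) := by
      refine (Real.rpow_le_rpow ht0.le ((ht.2.trans (le_abs_self _)).trans (le_max_right 1 _))
        (by linarith [hqδ y hy])).trans ?_
      refine Real.rpow_le_rpow_of_exponent_le (le_max_left _ _) ?_
      linarith [le_abs_self (q y), hqD y hy, neg_abs_le (η + δ)]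
    rw [hsplit, mul_pow]
    have hL : (1 + |Real.log t|) ^ m ≤ (1 + |Real.log t|) ^ l :=
      pow_le_pow_right₀ (by linarith [abs_nonneg (Real.log t)]) hm
    calc (m.factorial : ℝ) * (t ^ (q y - (η + δ)) * t ^ δ * t ^ η) *
          ((D + 1) ^ m * (1 + |Real.log t|) ^ m)
        ≤ l.factorial * (max 1 |t₀| ^ (D + |η + δ|) * t ^ δ * t ^ η) *
          ((D + 1) ^ l * (1 + |Real.log t|) ^ l) := by
          gcongr
          linarith
      _ = l.factorial * (max 1 |t₀| ^ (D + |η + δ|) *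
          ((t ^ δ * (1 + |Real.log t|) ^ l) * (D + 1) ^ l)) * t ^ η := by ring
      _ ≤ _ := by
          gcongr
          exact hBt t ht

end UnifCl

end UniformBounds

end BigBang

namespace BigBang

/-! ### The triangular matrices and the coefficients `b_AB` -/

section Components

variable {M : Type*}

/-- The components of `triFrame`: the entry `(A, i)` is the `i`-th coordinate of `X_A`. -/
noncomputable def frameMatrix (X12 X13 X23 : M → ℝ) (A i : Fin 3) (x : M) : ℝ :=
  !![1, X12 x, X13 x; 0, 1, X23 x; 0, 0, 1] A i

/-- The components of `triCoframe`: the entry `(A, i)` is the coefficient of `dxⁱ` in `Y^A`. -/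
noncomputable def coframeMatrix (X12 X13 X23 : M → ℝ) (A i : Fin 3) (x : M) : ℝ :=
  !![1, 0, 0; -X12 x, 1, 0; X12 x * X23 x - X13 x, -X23 x, 1] A i

/-- If, say, `max A B = A`, then `i < A`, and `X_Aⁱ` lies below the diagonal. This removes the terms
of `b_AB` with a negative power of `t`. -/
theorem frameMatrix_mul_eq_zero (X12 X13 X23 : M → ℝ) {A B i j : Fin 3}
    (h : max i j < max A B) (x : M) :
    frameMatrix X12 X13 X23 A i x * frameMatrix X12 X13 X23 B j x = 0 := by
  have key : ∀ A i : Fin 3, i < A → frameMatrix X12 X13 X23 A i x = 0 := by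
    intro A i hi
    fin_cases A <;> fin_cases i <;> simp_all [frameMatrix]
  rcases lt_max_iff.1 h with h1 | h1
  · rw [key A i ((le_max_left _ _).trans_lt h1), zero_mul]
  · rw [key B j ((le_max_right _ _).trans_lt h1), mul_zero]

/-- The coefficients `b_AB` of the induced metrics with respect to the triangular coframe, the
coefficients with respect to the coordinate coframe being `aᵢⱼ`. -/
noncomputable def frameCoeff (p : Fin 3 → M → ℝ) (X12 X13 X23 : M → ℝ)
    (a : Fin 3 → Fin 3 → ℝ → M → ℝ) (A B : Fin 3) (t : ℝ) (x : M) : ℝ :=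
  ∑ i, ∑ j, a i j t x * (t ^ (2 * p (max i j) x - 2 * p (max A B) x) *
    (frameMatrix X12 X13 X23 A i x * frameMatrix X12 X13 X23 B j x))

theorem frameCoeff_comm {p : Fin 3 → M → ℝ} {X12 X13 X23 : M → ℝ}
    {a : Fin 3 → Fin 3 → ℝ → M → ℝ} {t : ℝ} {x : M} (ha : ∀ i j, a i j t x = a j i t x)
    (A B : Fin 3) :
    frameCoeff p X12 X13 X23 a A B t x = frameCoeff p X12 X13 X23 a B A t x := by
  simp only [frameCoeff]
  rw [Finset.sum_comm]
  refine Finset.sum_congr rfl fun i _ => Finset.sum_congr rfl fun j _ => ?_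
  rw [ha j i, max_comm j i, max_comm A B]
  ring

end Components

/-! ### The eigenframe, and `𝒦`, `c`, `κ` and `h` in terms of it -/

section Geometry

variable {M : Type*} [TopologicalSpace M] [ChartedSpace E3 M]
  {φ : OpenPartialHomeomorph M E3} {x : M}

theorem coordForm_add (i : Fin 3) (v w : TangentSpace (𝓡 3) x) :
    coordForm φ i x (v + w) = coordForm φ i x v + coordForm φ i x w := by
  simp only [coordForm, map_add]
  rfl

theorem coordForm_smul (i : Fin 3) (r : ℝ) (v : TangentSpace (𝓡 3) x) :
    coordForm φ i x (r • v) = r * coordForm φ i x v := by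
  simp only [coordForm, map_smul]
  rfl

theorem mdifferentiable_of_mem_maximalAtlas (hφ : φ ∈ IsManifold.maximalAtlas (𝓡 3) ∞ M) :
    φ.MDifferentiable (𝓡 3) 𝓘(ℝ, E3) :=
  ⟨(contMDiffOn_of_mem_maximalAtlas hφ).mdifferentiableOn (by simp),
    (contMDiffOn_symm_of_mem_maximalAtlas hφ).mdifferentiableOn (by simp)⟩

theorem triFrame_eq_sum (X12 X13 X23 : M → ℝ) (A : Fin 3) :
    triFrame φ X12 X13 X23 A x = ∑ i, frameMatrix X12 X13 X23 A i x • coordVF φ i x := by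
  fin_cases A <;> simp [triFrame, frameMatrix, Fin.sum_univ_three]

theorem triCoframe_eq_sum (X12 X13 X23 : M → ℝ) (A : Fin 3) (v : TangentSpace (𝓡 3) x) :
    triCoframe φ X12 X13 X23 A x v =
      ∑ i, coframeMatrix X12 X13 X23 A i x * coordForm φ i x v := by
  fin_cases A <;> simp [triCoframe, coframeMatrix, Fin.sum_univ_three]
  all_goals ring

theorem coordForm_eq_sum (X12 X13 X23 : M → ℝ) (i : Fin 3) (v : TangentSpace (𝓡 3) x) :
    coordForm φ i x v = ∑ A, frameMatrix X12 X13 X23 A i x * triCoframe φ X12 X13 X23 A x v := by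
  fin_cases i <;> simp [triCoframe, frameMatrix, Fin.sum_univ_three]
  all_goals ring

theorem coordVF_eq_sum (X12 X13 X23 : M → ℝ) (i : Fin 3) :
    coordVF φ i x = ∑ A, coframeMatrix X12 X13 X23 A i x • triFrame φ X12 X13 X23 A x := by
  fin_cases i <;> simp [triFrame, coframeMatrix, Fin.sum_univ_three]
  all_goals module

theorem sum_coordForm_smul_coordVF (hφ : φ ∈ IsManifold.maximalAtlas (𝓡 3) ∞ M)
    (hx : x ∈ φ.source) (v : TangentSpace (𝓡 3) x) :
    ∑ i, coordForm φ i x v • coordVF φ i x = v := by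
  have h1 := (mdifferentiable_of_mem_maximalAtlas hφ).symm_comp_deriv hx
  set A : E3 →L[ℝ] TangentSpace (𝓡 3) x := mfderiv 𝓘(ℝ, E3) (𝓡 3) φ.symm (φ x) with hA
  set B : TangentSpace (𝓡 3) x →L[ℝ] E3 := mfderiv (𝓡 3) 𝓘(ℝ, E3) φ x with hB
  have h2 : A (B v) = v := congrArg (fun L : TangentSpace (𝓡 3) x →L[ℝ] TangentSpace (𝓡 3) x => L v) h1
  have h3 : B v = ∑ i, (B v) i • EuclideanSpace.single i (1 : ℝ) := by
    ext j
    simp [Finset.sum_apply, Pi.single_apply]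
  have h4 : A (B v) = ∑ i, (B v) i • A (EuclideanSpace.single i (1 : ℝ)) := by
    conv_lhs => rw [h3]
    rw [map_sum]
    simp only [map_smul]
  exact h4.symm.trans h2

variable [IsManifold (𝓡 3) ∞ M]

/-- The field is the image of a constant field on `E3` under the tangent map of `φ.symm`. -/
theorem contMDiffOn_coordVF (hφ : φ ∈ IsManifold.maximalAtlas (𝓡 3) ∞ M) (i : Fin 3) :
    ContMDiffOn (𝓡 3) (𝓡 3).tangent ∞
      (fun x => Bundle.TotalSpace.mk' E3 (E := fun x : M => TangentSpace (𝓡 3) x) x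
        (coordVF φ i x)) φ.source := by
  have h1 := (contMDiffOn_symm_of_mem_maximalAtlas hφ).contMDiffOn_tangentMapWithin (m := ∞)
    (by simp) φ.open_target.uniqueMDiffOn
  have h2 : ContMDiff 𝓘(ℝ, E3) 𝓘(ℝ, E3).tangent ∞ (fun y : E3 =>
      Bundle.TotalSpace.mk' E3 (E := fun y : E3 => TangentSpace 𝓘(ℝ, E3) y) y
        (EuclideanSpace.single i (1 : ℝ) : E3)) :=
    contMDiff_vectorSpace_iff_contDiff.2 contDiff_const
  have h3 := h1.comp (h2.comp_contMDiffOn (contMDiffOn_of_mem_maximalAtlas hφ))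
    (fun x hx => φ.map_source hx)
  refine h3.congr fun x hx => ?_
  have hw : mfderivWithin 𝓘(ℝ, E3) (𝓡 3) φ.symm φ.target (φ x) =
      mfderiv 𝓘(ℝ, E3) (𝓡 3) φ.symm (φ x) :=
    mfderivWithin_of_isOpen φ.open_target (φ.map_source hx)
  simp only [Function.comp_apply, tangentMapWithin, hw]
  exact Bundle.TotalSpace.ext (φ.left_inv hx).symm HEq.rfl

theorem contMDiffOn_coordForm (hφ : φ ∈ IsManifold.maximalAtlas (𝓡 3) ∞ M) (i : Fin 3)
    {v : ∀ x : M, TangentSpace (𝓡 3) x}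
    (hv : ContMDiffOn (𝓡 3) (𝓡 3).tangent ∞
      (fun x => Bundle.TotalSpace.mk' E3 (E := fun x : M => TangentSpace (𝓡 3) x) x (v x))
      φ.source) :
    ContMDiffOn (𝓡 3) 𝓘(ℝ, ℝ) ∞ (fun x => coordForm φ i x (v x)) φ.source := by
  have h1 := (contMDiffOn_of_mem_maximalAtlas hφ).contMDiffOn_tangentMapWithin (m := ∞)
    (by simp) φ.open_source.uniqueMDiffOn
  have h2 := (contMDiff_snd_tangentBundle_modelSpace (n := ∞) E3 𝓘(ℝ, E3)).comp_contMDiffOn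
    (h1.comp hv (fun x hx => hx))
  have h3 : ContMDiff 𝓘(ℝ, E3) 𝓘(ℝ, ℝ) ∞ (fun y : E3 => y i) :=
    (EuclideanSpace.proj i : E3 →L[ℝ] ℝ).contDiff.contMDiff
  refine (h3.comp_contMDiffOn h2).congr fun x hx => ?_
  have hw : mfderivWithin (𝓡 3) 𝓘(ℝ, E3) φ φ.source x = mfderiv (𝓡 3) 𝓘(ℝ, E3) φ x :=
    mfderivWithin_of_isOpen φ.open_source hx
  exact (congrArg (fun L : TangentSpace (𝓡 3) x →L[ℝ] E3 => (L (v x)) i) hw).symm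

theorem contMDiffOn_comp11 (hφ : φ ∈ IsManifold.maximalAtlas (𝓡 3) ∞ M)
    {K : ∀ x : M, TangentSpace (𝓡 3) x →L[ℝ] TangentSpace (𝓡 3) x}
    (hK : ContMDiff (𝓡 3) ((𝓡 3).prod 𝓘(ℝ, E3 →L[ℝ] E3)) ∞
      (fun x : M => Bundle.TotalSpace.mk' (E3 →L[ℝ] E3)
        (E := fun x : M => TangentSpace (𝓡 3) x →L[ℝ] TangentSpace (𝓡 3) x) x (K x)))
    (i j : Fin 3) : ContMDiffOn (𝓡 3) 𝓘(ℝ, ℝ) ∞ (comp11 φ K i j) φ.source := by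
  have h1 := ContMDiffOn.clm_bundle_apply (b := fun x : M => x) (hK.contMDiffOn (s := φ.source))
    (contMDiffOn_coordVF hφ i)
  exact contMDiffOn_coordForm hφ j h1

theorem contMDiffOn_comp02 (hφ : φ ∈ IsManifold.maximalAtlas (𝓡 3) ∞ M)
    (h : Bundle.ContMDiffRiemannianMetric (𝓡 3) ∞ E3 (fun x : M => TangentSpace (𝓡 3) x))
    (i j : Fin 3) :
    ContMDiffOn (𝓡 3) 𝓘(ℝ, ℝ) ∞ (comp02 φ (fun x v w => h.inner x v w) i j) φ.source := by
  intro x hx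
  have : ContMDiffWithinAt (𝓡 3) ((𝓡 3).prod 𝓘(ℝ)) ∞
      (fun m : M => Bundle.TotalSpace.mk' ℝ (E := Bundle.Trivial M ℝ) m
        (h.inner m (coordVF φ i m) (coordVF φ j m))) φ.source x := by
    apply ContMDiffWithinAt.clm_bundle_apply₂ (F₁ := E3) (F₂ := E3)
    · exact h.contMDiff.contMDiffAt.contMDiffWithinAt
    · exact contMDiffOn_coordVF hφ i x hx
    · exact contMDiffOn_coordVF hφ j x hx
  simp only [Bundle.contMDiffWithinAt_totalSpace] at this
  exact this.2

theorem triCoframe_coordVF (hφ : φ ∈ IsManifold.maximalAtlas (𝓡 3) ∞ M) (hx : x ∈ φ.source)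
    (X12 X13 X23 : M → ℝ) (A i : Fin 3) :
    triCoframe φ X12 X13 X23 A x (coordVF φ i x) = coframeMatrix X12 X13 X23 A i x := by
  simp [triCoframe_eq_sum, coordForm_coordVF hφ hx]

theorem triFrame_ne_zero (hφ : φ ∈ IsManifold.maximalAtlas (𝓡 3) ∞ M) (hx : x ∈ φ.source)
    (X12 X13 X23 : M → ℝ) (A : Fin 3) : triFrame φ X12 X13 X23 A x ≠ 0 := by
  intro h0
  have h1 := triCoframe_triFrame hφ hx X12 X13 X23 A A
  have hz : ∀ i, coordForm φ i x (0 : TangentSpace (𝓡 3) x) = 0 := fun i => by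
    simpa using coordForm_smul (φ := φ) i 0 (0 : TangentSpace (𝓡 3) x)
  rw [h0, triCoframe_eq_sum] at h1
  simp [hz] at h1

/-- The eigenvector equations are solved from `X₃ = ∂₃` upwards. The diagonal also shows that `p_A`
is a component of `𝒦`, whence its smoothness. -/
theorem comp11_eq (hφ : φ ∈ IsManifold.maximalAtlas (𝓡 3) ∞ M) (hx : x ∈ φ.source)
    {K : ∀ x : M, TangentSpace (𝓡 3) x →L[ℝ] TangentSpace (𝓡 3) x} {p : Fin 3 → M → ℝ}
    {X12 X13 X23 : M → ℝ}
    (hX : ∀ A, K x (triFrame φ X12 X13 X23 A x) = p A x • triFrame φ X12 X13 X23 A x)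
    (i j : Fin 3) :
    comp11 φ K i j x =
      !![p 0 x, (p 0 x - p 1 x) * X12 x,
          (p 0 x - p 2 x) * X13 x - (p 1 x - p 2 x) * X12 x * X23 x;
        0, p 1 x, (p 1 x - p 2 x) * X23 x;
        0, 0, p 2 x] i j := by
  have e2 : K x (coordVF φ 2 x) = p 2 x • coordVF φ 2 x := hX 2
  have h1 : K x (coordVF φ 1 x + X23 x • coordVF φ 2 x) =
    p 1 x • (coordVF φ 1 x + X23 x • coordVF φ 2 x) := hX 1
  have h0 : K x (coordVF φ 0 x + X12 x • coordVF φ 1 x + X13 x • coordVF φ 2 x) =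
    p 0 x • (coordVF φ 0 x + X12 x • coordVF φ 1 x + X13 x • coordVF φ 2 x) := hX 0
  rw [map_add, map_smul, e2] at h1
  have e1 : K x (coordVF φ 1 x) =
      p 1 x • coordVF φ 1 x + ((p 1 x - p 2 x) * X23 x) • coordVF φ 2 x := by
    rw [eq_sub_of_add_eq h1]
    module
  rw [map_add, map_add, map_smul, map_smul, e2, e1] at h0
  have e0 : K x (coordVF φ 0 x) = p 0 x • coordVF φ 0 x + ((p 0 x - p 1 x) * X12 x) • coordVF φ 1 x
      + ((p 0 x - p 2 x) * X13 x - (p 1 x - p 2 x) * X12 x * X23 x) • coordVF φ 2 x := by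
    rw [eq_sub_of_add_eq (eq_sub_of_add_eq h0)]
    module
  have hv := coordForm_coordVF hφ hx
  fin_cases i <;> fin_cases j <;>
    simp [comp11, e0, e1, e2, coordForm_add, coordForm_smul, hv]

/-- The eigenvalue differences cancel. What remains is `cᵢⱼ = c_jj Y^j(∂ᵢ)` for `i ≤ j`. -/
theorem limitC_eq (hφ : φ ∈ IsManifold.maximalAtlas (𝓡 3) ∞ M) (hx : x ∈ φ.source)
    (h : ∀ x : M, TangentSpace (𝓡 3) x → TangentSpace (𝓡 3) x → ℝ)
    {K : ∀ x : M, TangentSpace (𝓡 3) x →L[ℝ] TangentSpace (𝓡 3) x} {p : Fin 3 → M → ℝ}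
    (hp : StrictMono fun A => p A x) {X12 X13 X23 : M → ℝ}
    (hX : ∀ A, K x (triFrame φ X12 X13 X23 A x) = p A x • triFrame φ X12 X13 X23 A x)
    {d : Fin 3 → ℝ}
    (hd : ∀ A, d A = h x (triFrame φ X12 X13 X23 A x) (triFrame φ X12 X13 X23 A x))
    (i j : Fin 3) :
    limitC φ h K p X12 X13 X23 i j x =
      !![d 0, -d 1 * X12 x, d 2 * (X12 x * X23 x - X13 x);
        -d 1 * X12 x, d 1, -d 2 * X23 x;
        d 2 * (X12 x * X23 x - X13 x), -d 2 * X23 x, d 2] i j := by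
  have h01 : p 1 x - p 0 x ≠ 0 := sub_ne_zero.2 (hp (show (0 : Fin 3) < 1 by decide)).ne'
  have h12 : p 2 x - p 1 x ≠ 0 := sub_ne_zero.2 (hp (show (1 : Fin 3) < 2 by decide)).ne'
  have h02 : p 2 x - p 0 x ≠ 0 := sub_ne_zero.2 (hp (show (0 : Fin 3) < 2 by decide)).ne'
  have c01 : comp11 φ K 0 1 x = (p 0 x - p 1 x) * X12 x := by simp [comp11_eq hφ hx hX]
  have c12 : comp11 φ K 1 2 x = (p 1 x - p 2 x) * X23 x := by simp [comp11_eq hφ hx hX]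
  have c02 : comp11 φ K 0 2 x = (p 0 x - p 2 x) * X13 x - (p 1 x - p 2 x) * X12 x * X23 x := by
    simp [comp11_eq hφ hx hX]
  have e01 : d 1 / (p 1 x - p 0 x) * comp11 φ K 0 1 x = -d 1 * X12 x := by
    rw [c01]; field_simp; ring
  have e12 : d 2 / (p 2 x - p 1 x) * comp11 φ K 1 2 x = -d 2 * X23 x := by
    rw [c12]; field_simp; ring
  have e02 : d 2 / (p 2 x - p 0 x) * (comp11 φ K 0 2 x +
      1 / (p 2 x - p 1 x) * comp11 φ K 0 1 x * comp11 φ K 1 2 x) =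
      d 2 * (X12 x * X23 x - X13 x) := by
    rw [c01, c12, c02]; field_simp; ring
  simp only [limitC, ← hd, e01, e12, e02]

/-- Through this identity the hypothesis on `t k̄ + κ` becomes convergence of `t K̄` to `𝒦`.
Positivity of `h` allows the division by `c_AA`. -/
theorem kappa_limitC_eq (hφ : φ ∈ IsManifold.maximalAtlas (𝓡 3) ∞ M) (hx : x ∈ φ.source)
    (h : ∀ x : M, TangentSpace (𝓡 3) x → TangentSpace (𝓡 3) x → ℝ)
    (hpos : ∀ v, v ≠ 0 → 0 < h x v v)
    {K : ∀ x : M, TangentSpace (𝓡 3) x →L[ℝ] TangentSpace (𝓡 3) x} {p : Fin 3 → M → ℝ}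
    (hp : StrictMono fun A => p A x) {X12 X13 X23 : M → ℝ}
    (hX : ∀ A, K x (triFrame φ X12 X13 X23 A x) = p A x • triFrame φ X12 X13 X23 A x)
    (i j : Fin 3) :
    kappa p (limitC φ h K p X12 X13 X23) i j x = -comp11 φ K i j x := by
  set d : Fin 3 → ℝ := fun A =>
    h x (triFrame φ X12 X13 X23 A x) (triFrame φ X12 X13 X23 A x) with hd
  have hd0 : ∀ A, d A ≠ 0 := fun A => (hpos _ (triFrame_ne_zero hφ hx X12 X13 X23 A)).ne'
  have hc := limitC_eq hφ hx h hp hX (d := d) (fun _ => rfl)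
  have h1 := hd0 1
  have h2 := hd0 2
  rw [comp11_eq hφ hx hX]
  fin_cases i <;> fin_cases j <;> simp [kappa, hc]
  all_goals field_simp
  all_goals ring

/-- The frame is a basis, as its dual coframe shows, and `𝒦` is diagonal in it. -/
theorem trace_eq_sum_of_triFrame (hφ : φ ∈ IsManifold.maximalAtlas (𝓡 3) ∞ M)
    (hx : x ∈ φ.source)
    {K : ∀ x : M, TangentSpace (𝓡 3) x →L[ℝ] TangentSpace (𝓡 3) x} {p : Fin 3 → M → ℝ}
    {X12 X13 X23 : M → ℝ}
    (hX : ∀ A, K x (triFrame φ X12 X13 X23 A x) = p A x • triFrame φ X12 X13 X23 A x) :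
    LinearMap.trace ℝ (TangentSpace (𝓡 3) x) (K x).toLinearMap = ∑ A, p A x := by
  have hsp : ∀ v : TangentSpace (𝓡 3) x,
      v = ∑ A, triCoframe φ X12 X13 X23 A x v • triFrame φ X12 X13 X23 A x := by
    intro v
    conv_lhs => rw [← sum_coordForm_smul_coordVF hφ hx v]
    simp only [triCoframe, triFrame, Fin.sum_univ_three, Matrix.cons_val_zero, Matrix.cons_val_one,
      Matrix.cons_val]
    module
  have hli : LinearIndependent ℝ fun A => triFrame φ X12 X13 X23 A x := by
    rw [Fintype.linearIndependent_iff]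
    intro g hg A
    have h1 : triCoframe φ X12 X13 X23 A x (∑ B, g B • triFrame φ X12 X13 X23 B x) = g A := by
      have add : ∀ v w : TangentSpace (𝓡 3) x, triCoframe φ X12 X13 X23 A x (v + w) =
          triCoframe φ X12 X13 X23 A x v + triCoframe φ X12 X13 X23 A x w := fun v w => by
        simp only [triCoframe_eq_sum, coordForm_add, mul_add, Finset.sum_add_distrib]
      have smul : ∀ (r : ℝ) (v : TangentSpace (𝓡 3) x), triCoframe φ X12 X13 X23 A x (r • v) =
          r * triCoframe φ X12 X13 X23 A x v := fun r v => by
        simp only [triCoframe_eq_sum, coordForm_smul, Finset.mul_sum]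
        exact Finset.sum_congr rfl fun i _ => by ring
      rw [Fin.sum_univ_three, add, add, smul, smul, smul]
      simp only [triCoframe_triFrame hφ hx]
      fin_cases A <;> simp
    rw [hg] at h1
    rw [← h1, triCoframe_eq_sum]
    have hz : ∀ i, coordForm φ i x (0 : TangentSpace (𝓡 3) x) = 0 := fun i => by
      simpa using coordForm_smul (φ := φ) i 0 (0 : TangentSpace (𝓡 3) x)
    simp [hz]
  let β := Module.Basis.mk hli (fun v _ => by
    rw [hsp v]
    exact Submodule.sum_mem _ fun A _ => Submodule.smul_mem _ _
      (Submodule.subset_span ⟨A, rfl⟩))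
  rw [LinearMap.trace_eq_matrix_trace ℝ β, Matrix.trace]
  refine Finset.sum_congr rfl fun A _ => ?_
  rw [Matrix.diag_apply, LinearMap.toMatrix_apply]
  have hβ : β A = triFrame φ X12 X13 X23 A x := by simp [β]
  have h2 : (K x).toLinearMap (β A) = p A x • β A := by
    rw [hβ]; exact hX A
  rw [h2]
  simp

/-- Eigenvectors of a symmetric map for distinct eigenvalues are orthogonal. -/
theorem inner_triFrame_eq
    (h : Bundle.ContMDiffRiemannianMetric (𝓡 3) ∞ E3 (fun x : M => TangentSpace (𝓡 3) x))
    {K : ∀ x : M, TangentSpace (𝓡 3) x →L[ℝ] TangentSpace (𝓡 3) x}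
    (hK : ∀ v w : TangentSpace (𝓡 3) x, h.inner x (K x v) w = h.inner x v (K x w))
    {p : Fin 3 → M → ℝ} (hp : StrictMono fun A => p A x) {X12 X13 X23 : M → ℝ}
    (hX : ∀ A, K x (triFrame φ X12 X13 X23 A x) = p A x • triFrame φ X12 X13 X23 A x)
    {A B : Fin 3} (hAB : A ≠ B) :
    h.inner x (triFrame φ X12 X13 X23 A x) (triFrame φ X12 X13 X23 B x) = 0 := by
  have h1 := hK (triFrame φ X12 X13 X23 A x) (triFrame φ X12 X13 X23 B x)
  rw [hX, hX] at h1
  simp only [map_smul, smul_apply, smul_eq_mul] at h1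
  have h2 : p A x - p B x ≠ 0 := sub_ne_zero.2 (hp.injective.ne hAB)
  have h3 : (p A x - p B x) *
      h.inner x (triFrame φ X12 X13 X23 A x) (triFrame φ X12 X13 X23 B x) = 0 := by linarith
  exact (mul_eq_zero.1 h3).resolve_left h2

/-- The diagonal form of `h` is written as a double sum so that it can be subtracted from `ȟ` term
by term. -/
theorem comp02_eq_sum (hφ : φ ∈ IsManifold.maximalAtlas (𝓡 3) ∞ M) (hx : x ∈ φ.source)
    (h : Bundle.ContMDiffRiemannianMetric (𝓡 3) ∞ E3 (fun x : M => TangentSpace (𝓡 3) x))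
    {K : ∀ x : M, TangentSpace (𝓡 3) x →L[ℝ] TangentSpace (𝓡 3) x}
    (hK : ∀ v w : TangentSpace (𝓡 3) x, h.inner x (K x v) w = h.inner x v (K x w))
    {p : Fin 3 → M → ℝ} (hp : StrictMono fun A => p A x) {X12 X13 X23 : M → ℝ}
    (hX : ∀ A, K x (triFrame φ X12 X13 X23 A x) = p A x • triFrame φ X12 X13 X23 A x)
    (i j : Fin 3) :
    comp02 φ (fun x v w => h.inner x v w) i j x = ∑ A, ∑ B,
      (if A = B then limitC φ (fun x v w => h.inner x v w) K p X12 X13 X23 A A x else 0) *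
        (coframeMatrix X12 X13 X23 A i x * coframeMatrix X12 X13 X23 B j x) := by
  have hAB : ∀ A B, h.inner x (triFrame φ X12 X13 X23 A x) (triFrame φ X12 X13 X23 B x) =
      if A = B then limitC φ (fun x v w => h.inner x v w) K p X12 X13 X23 A A x else 0 := by
    intro A B
    split_ifs with hc
    · subst hc
      rw [limitC_eq hφ hx (fun x v w => h.inner x v w) hp hX (d := fun A =>
        h.inner x (triFrame φ X12 X13 X23 A x) (triFrame φ X12 X13 X23 A x)) (fun _ => rfl)]
      fin_cases A <;> rfl
    · exact inner_triFrame_eq h hK hp hX hc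
  simp only [comp02]
  rw [coordVF_eq_sum X12 X13 X23 i, coordVF_eq_sum X12 X13 X23 j]
  simp only [map_sum, map_smul, sum_apply, smul_apply,
    hAB, smul_eq_mul]
  rw [Finset.sum_comm]
  refine Finset.sum_congr rfl fun A _ => ?_
  rw [Finset.mul_sum]
  exact Finset.sum_congr rfl fun B _ => by ring

end Geometry

end BigBang

namespace BigBang

/-! ### Joint smoothness in space and time -/

section Smoothness

variable {E : Type*} [NormedAddCommGroup E] [NormedSpace ℝ E]

/-- The one-sided time derivative is the Fréchet derivative within `J ×ˢ U` in the direction `(1,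
0)`. -/
theorem contDiffOn_derivWithin_fst {F : ℝ × E → ℝ} {J : Set ℝ} {U : Set E}
    (hJ : UniqueDiffOn ℝ J) (hU : IsOpen U) (hF : ContDiffOn ℝ ∞ F (J ×ˢ U)) :
    ContDiffOn ℝ ∞ (fun q : ℝ × E => derivWithin (fun s => F (s, q.2)) J q.1) (J ×ˢ U) := by
  have h1 : ContDiffOn ℝ ∞ (fun q => fderivWithin ℝ F (J ×ˢ U) q (1, 0)) (J ×ˢ U) :=
    (hF.fderivWithin (m := ∞) (hJ.prod hU.uniqueDiffOn) (by simp)).clm_apply contDiffOn_const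
  refine h1.congr fun q hq => ?_
  have h2 : HasFDerivWithinAt F (fderivWithin ℝ F (J ×ˢ U) q) (J ×ˢ U) (q.1, q.2) :=
    (hF.differentiableOn (by simp) q hq).hasFDerivWithinAt
  have h3 : HasDerivWithinAt (fun s : ℝ => (s, q.2)) ((1 : ℝ), (0 : E)) J q.1 :=
    (hasDerivWithinAt_id q.1 J).prodMk (hasDerivWithinAt_const q.1 J q.2)
  have h4 : Set.MapsTo (fun s : ℝ => (s, q.2)) J (J ×ˢ U) := fun s hs => ⟨hs, hq.2⟩
  exact (h2.comp_hasDerivWithinAt q.1 h3 h4).derivWithin (hJ q.1 hq.1)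

theorem contDiffOn_det {n : Type*} [Fintype n] [DecidableEq n] {s : Set E}
    {A : E → Matrix n n ℝ} (hA : ∀ i j, ContDiffOn ℝ ∞ (fun y => A y i j) s) :
    ContDiffOn ℝ ∞ (fun y => (A y).det) s := by
  simp only [Matrix.det_apply']
  exact ContDiffOn.sum fun σ _ => contDiffOn_const.mul (contDiffOn_prod fun i _ => hA _ _)

/-- Cramer's rule: the entries of the adjugate are determinants of `A` with one row made constant.
-/
theorem contDiffOn_matrix_inv {n : Type*} [Fintype n] [DecidableEq n] {s : Set E}
    {A : E → Matrix n n ℝ} (hA : ∀ i j, ContDiffOn ℝ ∞ (fun y => A y i j) s)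
    (hdet : ∀ y ∈ s, (A y).det ≠ 0) (i j : n) :
    ContDiffOn ℝ ∞ (fun y => (A y)⁻¹ i j) s := by
  simp only [Matrix.inv_def, Matrix.smul_apply, Ring.inverse_eq_inv', smul_eq_mul,
    Matrix.adjugate_apply]
  refine ((contDiffOn_det hA).inv hdet).mul (contDiffOn_det fun k l => ?_)
  by_cases hk : k = j
  · subst hk
    simpa using contDiffOn_const
  · simpa [Matrix.updateRow_ne hk] using hA k l

variable {M : Type*} [TopologicalSpace M] [ChartedSpace E3 M] {φ : OpenPartialHomeomorph M E3}

theorem contDiffOn_comp_symm (hφ : φ ∈ IsManifold.maximalAtlas (𝓡 3) ∞ M) {f : M → ℝ}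
    (hf : ContMDiffOn (𝓡 3) 𝓘(ℝ, ℝ) ∞ f φ.source) :
    ContDiffOn ℝ ∞ (fun y => f (φ.symm y)) φ.target :=
  contMDiffOn_iff_contDiffOn.1 (hf.comp (contMDiffOn_symm_of_mem_maximalAtlas hφ)
    fun _ hy => φ.map_target hy)

theorem contDiffOn_prod_symm (hφ : φ ∈ IsManifold.maximalAtlas (𝓡 3) ∞ M) {f : M × ℝ → ℝ}
    {J : Set ℝ} (hf : ContMDiffOn ((𝓡 3).prod 𝓘(ℝ, ℝ)) 𝓘(ℝ, ℝ) ∞ f (φ.source ×ˢ J)) :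
    ContDiffOn ℝ ∞ (fun q : ℝ × E3 => f (φ.symm q.2, q.1)) (J ×ˢ φ.target) := by
  refine contMDiffOn_iff_contDiffOn.1 (hf.comp (ContMDiffOn.prodMk (I := 𝓘(ℝ, ℝ × E3))
    ((contMDiffOn_symm_of_mem_maximalAtlas hφ).comp (I' := 𝓘(ℝ, E3))
      (contDiff_snd.contMDiff (f := (Prod.snd : ℝ × E3 → E3))).contMDiffOn
      (fun q (hq : q ∈ J ×ˢ φ.target) => hq.2))
    (contDiff_fst.contMDiff (f := (Prod.fst : ℝ × E3 → ℝ))).contMDiffOn)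
    fun q hq => ⟨φ.map_target hq.2, hq.1⟩)

theorem contMDiffOn_rpow {U : Set M} {t₀ : ℝ} {q : M → ℝ}
    (hq : ContMDiffOn (𝓡 3) 𝓘(ℝ, ℝ) ∞ q U) :
    ContMDiffOn ((𝓡 3).prod 𝓘(ℝ, ℝ)) 𝓘(ℝ, ℝ) ∞ (fun z : M × ℝ => z.2 ^ q z.1)
      (U ×ˢ Set.Ioc 0 t₀) := by
  have h1 : ContMDiffOn ((𝓡 3).prod 𝓘(ℝ, ℝ)) 𝓘(ℝ, ℝ) ∞ (fun z : M × ℝ => q z.1)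
      (U ×ˢ Set.Ioc 0 t₀) := hq.comp contMDiffOn_fst fun z hz => hz.1
  have h2 : ContMDiffOn ((𝓡 3).prod 𝓘(ℝ, ℝ)) 𝓘(ℝ, ℝ) ∞ (fun z : M × ℝ => Real.log z.2)
      (U ×ˢ Set.Ioc 0 t₀) :=
    (Real.contDiffOn_log.contMDiffOn).comp contMDiffOn_snd fun z hz => hz.2.1.ne'
  exact (Real.contDiff_exp.contMDiff.comp_contMDiffOn (h2.mul h1)).congr fun z hz =>
    Real.rpow_def_of_pos hz.2.1 _

theorem contMDiffOn_sum {N : Type*} [TopologicalSpace N] {H F : Type*} [TopologicalSpace H]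
    [NormedAddCommGroup F] [NormedSpace ℝ F] {I : ModelWithCorners ℝ F H} [ChartedSpace H N]
    {ι : Type*} {s : Finset ι} {U : Set N} {f : ι → N → ℝ}
    (h : ∀ i ∈ s, ContMDiffOn I 𝓘(ℝ, ℝ) ∞ (f i) U) :
    ContMDiffOn I 𝓘(ℝ, ℝ) ∞ (fun x => ∑ i ∈ s, f i x) U := by
  classical
  induction s using Finset.induction_on with
  | empty => simpa using contMDiffOn_const
  | insert i s hi ih =>
    simp only [Finset.sum_insert hi]
    exact (h i (by simp)).add (ih fun j hj => h j (by simp [hj]))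

theorem contMDiffOn_frameMatrix {U : Set M} {X12 X13 X23 : M → ℝ}
    (hX12 : ContMDiffOn (𝓡 3) 𝓘(ℝ, ℝ) ∞ X12 U) (hX13 : ContMDiffOn (𝓡 3) 𝓘(ℝ, ℝ) ∞ X13 U)
    (hX23 : ContMDiffOn (𝓡 3) 𝓘(ℝ, ℝ) ∞ X23 U) (A i : Fin 3) :
    ContMDiffOn (𝓡 3) 𝓘(ℝ, ℝ) ∞ (frameMatrix X12 X13 X23 A i) U := by
  fin_cases A <;> fin_cases i
  all_goals first
    | exact hX12 | exact hX13 | exact hX23 | exact contMDiffOn_const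

theorem contMDiffOn_coframeMatrix {U : Set M} {X12 X13 X23 : M → ℝ}
    (hX12 : ContMDiffOn (𝓡 3) 𝓘(ℝ, ℝ) ∞ X12 U) (hX13 : ContMDiffOn (𝓡 3) 𝓘(ℝ, ℝ) ∞ X13 U)
    (hX23 : ContMDiffOn (𝓡 3) 𝓘(ℝ, ℝ) ∞ X23 U) (A i : Fin 3) :
    ContMDiffOn (𝓡 3) 𝓘(ℝ, ℝ) ∞ (coframeMatrix X12 X13 X23 A i) U := by
  fin_cases A <;> fin_cases i
  all_goals first
    | exact hX12.neg | exact hX23.neg | exact (hX12.mul hX23).sub hX13 | exact contMDiffOn_const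

theorem contMDiffOn_frameCoeff {U : Set M} {t₀ : ℝ} {p : Fin 3 → M → ℝ}
    (hp : ∀ A, ContMDiffOn (𝓡 3) 𝓘(ℝ, ℝ) ∞ (p A) U) {X12 X13 X23 : M → ℝ}
    (hX12 : ContMDiffOn (𝓡 3) 𝓘(ℝ, ℝ) ∞ X12 U) (hX13 : ContMDiffOn (𝓡 3) 𝓘(ℝ, ℝ) ∞ X13 U)
    (hX23 : ContMDiffOn (𝓡 3) 𝓘(ℝ, ℝ) ∞ X23 U) {a : Fin 3 → Fin 3 → ℝ → M → ℝ}
    (ha : ∀ i j, ContMDiffOn ((𝓡 3).prod 𝓘(ℝ, ℝ)) 𝓘(ℝ, ℝ) ∞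
      (fun q : M × ℝ => a i j q.2 q.1) (U ×ˢ Set.Ioc 0 t₀)) (A B : Fin 3) :
    ContMDiffOn ((𝓡 3).prod 𝓘(ℝ, ℝ)) 𝓘(ℝ, ℝ) ∞
      (fun q : M × ℝ => frameCoeff p X12 X13 X23 a A B q.2 q.1) (U ×ˢ Set.Ioc 0 t₀) := by
  have hX : ∀ A i, ContMDiffOn ((𝓡 3).prod 𝓘(ℝ, ℝ)) 𝓘(ℝ, ℝ) ∞
      (fun q : M × ℝ => frameMatrix X12 X13 X23 A i q.1) (U ×ˢ Set.Ioc 0 t₀) := fun A i =>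
    (contMDiffOn_frameMatrix hX12 hX13 hX23 A i).comp contMDiffOn_fst fun z hz => hz.1
  refine contMDiffOn_sum fun i _ => contMDiffOn_sum fun j _ => (ha i j).mul ?_
  refine (contMDiffOn_rpow (q := fun x => 2 * p (max i j) x - 2 * p (max A B) x) ?_).mul
    ((hX A i).mul (hX B j))
  exact (contMDiffOn_const.mul (hp _)).sub (contMDiffOn_const.mul (hp _))

/-- Insert `dxⁱ = ∑_A X_Aⁱ Y^A`; the exponent in `frameCoeff` was chosen to compensate the change of
weight. -/
theorem gaussMetric_coordForm_eq {p : Fin 3 → M → ℝ} {X12 X13 X23 : M → ℝ}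
    {a : Fin 3 → Fin 3 → ℝ → M → ℝ} {t : ℝ} (ht : 0 < t) {x : M}
    (u w : TangentSpace (𝓡 3) x × ℝ) :
    gaussMetric (coordForm φ) p a t x u w =
      gaussMetric (triCoframe φ X12 X13 X23) p (frameCoeff p X12 X13 X23 a) t x u w := by
  simp only [gaussMetric]
  congr 1
  have h1 : ∀ A B, frameCoeff p X12 X13 X23 a A B t x * t ^ (2 * p (max A B) x) =
      ∑ i, ∑ j, a i j t x * t ^ (2 * p (max i j) x) *
        (frameMatrix X12 X13 X23 A i x * frameMatrix X12 X13 X23 B j x) := by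
    intro A B
    simp only [frameCoeff, Finset.sum_mul]
    refine Finset.sum_congr rfl fun i _ => Finset.sum_congr rfl fun j _ => ?_
    have h2 : t ^ (2 * p (max i j) x) =
        t ^ (2 * p (max i j) x - 2 * p (max A B) x) * t ^ (2 * p (max A B) x) := by
      rw [← Real.rpow_add ht]; congr 1; ring
    rw [h2]; ring
  simp only [h1, coordForm_eq_sum X12 X13 X23]
  simp only [Fin.sum_univ_three]
  ring

theorem comp02_inducedMetric [IsManifold (𝓡 3) ∞ M]
    (hφ : φ ∈ IsManifold.maximalAtlas (𝓡 3) ∞ M) {x : M} (hx : x ∈ φ.source)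
    (p : Fin 3 → M → ℝ) (a : Fin 3 → Fin 3 → ℝ → M → ℝ) (t : ℝ) (i j : Fin 3) :
    comp02 φ (inducedMetric (gaussMetric (coordForm φ) p a) t) i j x =
      a i j t x * t ^ (2 * p (max i j) x) := by
  simp [comp02, inducedMetric, gaussMetric, coordForm_coordVF hφ hx]

/-- A kernel vector of the matrix would be a nonzero tangent vector of length zero. -/
theorem det_comp02_ne_zero [IsManifold (𝓡 3) ∞ M]
    (hφ : φ ∈ IsManifold.maximalAtlas (𝓡 3) ∞ M) {x : M} (hx : x ∈ φ.source)
    {p : Fin 3 → M → ℝ} {a : Fin 3 → Fin 3 → ℝ → M → ℝ} {t : ℝ}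
    (hpos : ∀ v : TangentSpace (𝓡 3) x, v ≠ 0 →
      0 < inducedMetric (gaussMetric (coordForm φ) p a) t x v v) :
    (Matrix.of fun r s =>
      comp02 φ (inducedMetric (gaussMetric (coordForm φ) p a) t) r s x).det ≠ 0 := by
  intro h0
  obtain ⟨v, hv, hMv⟩ := Matrix.exists_mulVec_eq_zero_iff.2 h0
  set V : TangentSpace (𝓡 3) x :=
    v 0 • coordVF φ 0 x + v 1 • coordVF φ 1 x + v 2 • coordVF φ 2 x with hV
  have hc : ∀ i, coordForm φ i x V = v i := by
    intro i
    simp only [hV, coordForm_add, coordForm_smul, coordForm_coordVF hφ hx]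
    fin_cases i <;> simp
  have hV0 : V ≠ 0 := by
    intro h
    apply hv
    funext i
    rw [← hc i, h]
    simpa using coordForm_smul (φ := φ) i 0 (0 : TangentSpace (𝓡 3) x)
  have h2 : inducedMetric (gaussMetric (coordForm φ) p a) t x V V = ∑ i, v i *
      (Matrix.of fun r s =>
        comp02 φ (inducedMetric (gaussMetric (coordForm φ) p a) t) r s x).mulVec v i := by
    simp only [Matrix.mulVec, dotProduct, Matrix.of_apply, comp02_inducedMetric hφ hx]
    simp only [inducedMetric, gaussMetric, hc, mul_zero, neg_zero, zero_add, Finset.mul_sum]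
    exact Finset.sum_congr rfl fun i _ => Finset.sum_congr rfl fun j _ => by ring
  have h3 := hpos V hV0
  rw [h2, hMv] at h3
  simp at h3

theorem contDiffOn_weingarten [IsManifold (𝓡 3) ∞ M]
    (hφ : φ ∈ IsManifold.maximalAtlas (𝓡 3) ∞ M) {p : Fin 3 → M → ℝ}
    (hp : ∀ A, ContMDiffOn (𝓡 3) 𝓘(ℝ, ℝ) ∞ (p A) φ.source) {a : Fin 3 → Fin 3 → ℝ → M → ℝ}
    {t₀ : ℝ} (hsol : IsVacuumSolution φ p a t₀) (i j : Fin 3) :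
    ContDiffOn ℝ ∞ (fun q : ℝ × E3 => weingarten φ (Set.Ioc 0 t₀)
      (inducedMetric (gaussMetric (coordForm φ) p a)) i j q.1 (φ.symm q.2))
      (Set.Ioc 0 t₀ ×ˢ φ.target) := by
  have hG : ∀ r s, ContDiffOn ℝ ∞ (fun q : ℝ × E3 =>
      comp02 φ (inducedMetric (gaussMetric (coordForm φ) p a) q.1) r s (φ.symm q.2))
      (Set.Ioc 0 t₀ ×ˢ φ.target) := fun r s => by
    refine contDiffOn_prod_symm hφ (f := fun z : M × ℝ =>
      comp02 φ (inducedMetric (gaussMetric (coordForm φ) p a) z.2) r s z.1) ?_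
    refine ((hsol.smooth r s).mul (contMDiffOn_rpow (q := fun x => 2 * p (max r s) x)
      (contMDiffOn_const.mul (hp _)))).congr fun z hz => ?_
    exact comp02_inducedMetric hφ hz.1 p a z.2 r s
  simp only [weingarten]
  refine ContDiffOn.sum fun l _ => ContDiffOn.mul ?_ ?_
  · refine contDiffOn_matrix_inv (A := fun q : ℝ × E3 => Matrix.of fun r s =>
      comp02 φ (inducedMetric (gaussMetric (coordForm φ) p a) q.1) r s (φ.symm q.2)) hG ?_ j l
    intro q hq
    exact det_comp02_ne_zero hφ (φ.map_target hq.2)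
      (hsol.pos q.1 hq.1 _ (φ.map_target hq.2))
  · exact contDiffOn_const.mul
      (contDiffOn_derivWithin_fst (uniqueDiffOn_Ioc 0 t₀) φ.open_target (hG l i))

end Smoothness

end BigBang

namespace BigBang

/-! ### Passage between `clNorm` and `UnifCl` -/

section Norms

variable {M : Type*} [TopologicalSpace M] {φ : OpenPartialHomeomorph M E3}
  {T : Set ℝ} {W : Set M} {l : ℕ} {w : ℝ → ℝ}

/-- The given constant may be negative, hence `|C|`. Smoothness is a separate input, since a finite
norm does not imply it. -/
theorem unifCl_of_clNorm_le {f : ℝ → M → ℝ} (hW : W ⊆ φ.source) (hw : ∀ t ∈ T, 0 ≤ w t)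
    (hf : ∀ t ∈ T, ContDiffOn ℝ ∞ (fun y => f t (φ.symm y)) φ.target) {C : ℝ}
    (h : ∀ t ∈ T, clNorm φ l W (f t) ≤ ENNReal.ofReal (C * w t)) :
    UnifCl T (φ '' W) l w (fun t y => f t (φ.symm y)) := by
  refine ⟨fun t ht y hy => ?_, |C|, abs_nonneg _, fun t ht y hy m hm => ?_⟩
  · obtain ⟨x, hx, rfl⟩ := hy
    exact (hf t ht).contDiffAt (φ.open_target.mem_nhds (φ.map_source (hW hx)))
  · obtain ⟨x, hx, rfl⟩ := hy
    have h1 : ‖iteratedFDeriv ℝ m (f t ∘ φ.symm) (φ x)‖ₑ ≤ clNorm φ l W (f t) := by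
      refine (le_iSup₂_of_le (f := fun x (_ : x ∈ W) =>
        ‖iteratedFDeriv ℝ m (f t ∘ φ.symm) (φ x)‖ₑ) x hx le_rfl).trans ?_
      exact Finset.single_le_sum (f := fun m => ⨆ x ∈ W,
        ‖iteratedFDeriv ℝ m (f t ∘ φ.symm) (φ x)‖ₑ) (fun _ _ => zero_le)
        (Finset.mem_range.2 (by omega))
    have h2 := h1.trans ((h t ht).trans (ENNReal.ofReal_le_ofReal
      (mul_le_mul_of_nonneg_right (le_abs_self C) (hw t ht))))
    rw [← ofReal_norm, ENNReal.ofReal_le_ofReal_iff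
      (mul_nonneg (abs_nonneg _) (hw t ht))] at h2
    exact h2

theorem clNorm_le_of_unifCl {f : ℝ → M → ℝ} (hw : ∀ t ∈ T, 0 ≤ w t)
    (h : UnifCl T (φ '' W) l w (fun t y => f t (φ.symm y))) :
    ∃ C, 0 ≤ C ∧ ∀ t ∈ T, clNorm φ l W (f t) ≤ ENNReal.ofReal (C * w t) := by
  obtain ⟨C, hC, hb⟩ := h.bound
  refine ⟨(l + 1 : ℕ) * C, by positivity, fun t ht => ?_⟩
  have hwt := hw t ht
  have h1 : ∀ m ∈ Finset.range (l + 1), (⨆ x ∈ W, ‖iteratedFDeriv ℝ m (f t ∘ φ.symm) (φ x)‖ₑ) ≤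
      ENNReal.ofReal (C * w t) := fun m hm => iSup₂_le fun x hx => by
    rw [← ofReal_norm]
    exact ENNReal.ofReal_le_ofReal
      (hb t ht (φ x) ⟨x, hx, rfl⟩ m (by have := Finset.mem_range.1 hm; omega))
  refine (Finset.sum_le_sum h1).trans ?_
  rw [Finset.sum_const, Finset.card_range, nsmul_eq_mul, mul_assoc,
    ENNReal.ofReal_mul (Nat.cast_nonneg _), ENNReal.ofReal_natCast]

theorem clTensorNorm_le_of_unifCl {f : Fin 3 → Fin 3 → ℝ → M → ℝ} (hw : ∀ t ∈ T, 0 ≤ w t)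
    (h : ∀ i j, UnifCl T (φ '' W) l w (fun t y => f i j t (φ.symm y))) :
    ∃ C : ℝ, ∀ t ∈ T,
      clTensorNorm φ l W (fun i j x => f i j t x) ≤ ENNReal.ofReal (C * w t) := by
  choose C hC hb using fun i j => clNorm_le_of_unifCl hw (h i j)
  refine ⟨∑ i, ∑ j, C i j, fun t ht => ?_⟩
  have hwt := hw t ht
  simp only [Finset.sum_mul]
  rw [ENNReal.ofReal_sum_of_nonneg fun i _ => Finset.sum_nonneg fun j _ =>
    mul_nonneg (hC i j) hwt]
  refine Finset.sum_le_sum fun i _ => ?_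
  rw [ENNReal.ofReal_sum_of_nonneg fun j _ => mul_nonneg (hC i j) hwt]
  exact Finset.sum_le_sum fun j _ => hb i j t ht

end Norms

/-! ### Eigenvalue gaps and the limit of `b_AB` -/

section Limits

theorem exists_pos_le_sub_of_isCompact {M : Type*} [TopologicalSpace M]
    {p : Fin 3 → M → ℝ} {Z : Set M} (hZ : IsCompact Z)
    (hp : ∀ x, StrictMono fun A => p A x) (hc : ∀ A, ContinuousOn (p A) Z) :
    ∃ δ, 0 < δ ∧ ∀ x ∈ Z, ∀ A B, A < B → δ ≤ p B x - p A x := by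
  have h : ∀ A B : Fin 3, ∃ δ, 0 < δ ∧ (A < B → ∀ x ∈ Z, δ ≤ p B x - p A x) := by
    intro A B
    by_cases hAB : A < B
    · obtain ⟨δ, hδ, h⟩ := hZ.exists_forall_le' ((hc B).sub (hc A)) (a := 0)
        fun x _ => sub_pos.2 (hp x hAB)
      exact ⟨δ, hδ, fun _ => h⟩
    · exact ⟨1, one_pos, fun h => absurd h hAB⟩
  choose δ hδ h using h
  refine ⟨Finset.univ.inf' Finset.univ_nonempty fun q : Fin 3 × Fin 3 => δ q.1 q.2,
    (Finset.lt_inf'_iff _).2 fun q _ => hδ _ _, fun x hx A B hAB => ?_⟩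
  exact (Finset.inf'_le (fun q : Fin 3 × Fin 3 => δ q.1 q.2) (Finset.mem_univ (A, B))).trans
    (h A B hAB x hx)

variable {M : Type*} [TopologicalSpace M] [ChartedSpace E3 M] {φ : OpenPartialHomeomorph M E3}

/-- For `A ≤ B`, triangularity leaves only `j = B` and `i ≤ B`. By `limitC_eq` the sum is then `c_BB
∑ᵢ Y^B(∂ᵢ) X_Aⁱ = c_BB Y^B(X_A)`, and duality of frame and coframe concludes. The other case is
symmetric. -/
theorem sum_limitC_frameMatrix [IsManifold (𝓡 3) ∞ M]
    (hφ : φ ∈ IsManifold.maximalAtlas (𝓡 3) ∞ M) {x : M} (hx : x ∈ φ.source)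
    (h : ∀ x : M, TangentSpace (𝓡 3) x → TangentSpace (𝓡 3) x → ℝ)
    {K : ∀ x : M, TangentSpace (𝓡 3) x →L[ℝ] TangentSpace (𝓡 3) x} {p : Fin 3 → M → ℝ}
    (hp : StrictMono fun A => p A x) {X12 X13 X23 : M → ℝ}
    (hX : ∀ A, K x (triFrame φ X12 X13 X23 A x) = p A x • triFrame φ X12 X13 X23 A x)
    (A B : Fin 3) :
    ∑ i, ∑ j, limitC φ h K p X12 X13 X23 i j x * (if max i j = max A B then
        frameMatrix X12 X13 X23 A i x * frameMatrix X12 X13 X23 B j x else 0) =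
      if A = B then limitC φ h K p X12 X13 X23 A A x else 0 := by
  simp only [limitC_eq hφ hx h hp hX (d := fun A =>
    h x (triFrame φ X12 X13 X23 A x) (triFrame φ X12 X13 X23 A x)) (fun _ => rfl)]
  fin_cases A <;> fin_cases B <;> simp [Fin.sum_univ_three, frameMatrix]
  all_goals ring

theorem contMDiffOn_limitC [IsManifold (𝓡 3) ∞ M]
    (hφ : φ ∈ IsManifold.maximalAtlas (𝓡 3) ∞ M)
    (h : Bundle.ContMDiffRiemannianMetric (𝓡 3) ∞ E3 (fun x : M => TangentSpace (𝓡 3) x))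
    {K : ∀ x : M, TangentSpace (𝓡 3) x →L[ℝ] TangentSpace (𝓡 3) x} {p : Fin 3 → M → ℝ}
    (hp : ∀ x, StrictMono fun A => p A x) {X12 X13 X23 : M → ℝ}
    (hX12 : ContMDiffOn (𝓡 3) 𝓘(ℝ, ℝ) ∞ X12 φ.source)
    (hX13 : ContMDiffOn (𝓡 3) 𝓘(ℝ, ℝ) ∞ X13 φ.source)
    (hX23 : ContMDiffOn (𝓡 3) 𝓘(ℝ, ℝ) ∞ X23 φ.source)
    (hX : ∀ A, ∀ x ∈ φ.source,
      K x (triFrame φ X12 X13 X23 A x) = p A x • triFrame φ X12 X13 X23 A x)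
    (i j : Fin 3) :
    ContMDiffOn (𝓡 3) 𝓘(ℝ, ℝ) ∞ (limitC φ (fun x v w => h.inner x v w) K p X12 X13 X23 i j)
      φ.source := by
  set d : Fin 3 → M → ℝ := fun A x =>
    h.inner x (triFrame φ X12 X13 X23 A x) (triFrame φ X12 X13 X23 A x) with hd
  have hds : ∀ A, ContMDiffOn (𝓡 3) 𝓘(ℝ, ℝ) ∞ (d A) φ.source := by
    intro A
    have h1 : d A = fun x => ∑ i, ∑ j, frameMatrix X12 X13 X23 A i x *
        frameMatrix X12 X13 X23 A j x * comp02 φ (fun x v w => h.inner x v w) j i x := by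
      funext x
      simp only [hd, triFrame_eq_sum, map_sum, map_smul, comp02, sum_apply, smul_apply,
        smul_eq_mul, Finset.mul_sum, mul_assoc]
    rw [h1]
    have hF := contMDiffOn_frameMatrix hX12 hX13 hX23
    exact contMDiffOn_sum fun i _ => contMDiffOn_sum fun j _ =>
      ((hF A i).mul (hF A j)).mul (contMDiffOn_comp02 hφ h j i)
  have h2 : ∀ x ∈ φ.source, _ := fun x hx =>
    limitC_eq hφ hx (fun x v w => h.inner x v w) (hp x) (fun A => hX A x hx)
      (d := fun A => d A x) (fun _ => rfl) i j
  have e01 := (hds 1).neg.mul hX12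
  have e12 := (hds 2).neg.mul hX23
  have e02 := (hds 2).mul ((hX12.mul hX23).sub hX13)
  refine ContMDiffOn.congr ?_ h2
  fin_cases i <;> fin_cases j
  · exact hds 0
  · exact e01
  · exact e02
  · exact e01
  · exact hds 1
  · exact e12
  · exact e02
  · exact e12
  · exact hds 2

end Limits

/-! ### Convergence of the coefficients and of quotients -/

section Convergence

variable {M : Type*} [TopologicalSpace M] {φ : OpenPartialHomeomorph M E3}

/-- In `b_AB`, the coefficient of `aᵢⱼ` converges to `X_Aⁱ X_Bʲ` if `max(i, j) = max(A, B)`, and to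
`0` otherwise. -/
theorem unifCl_rpow_mul_frameMatrix_sub {p : Fin 3 → M → ℝ} {X12 X13 X23 : M → ℝ} {Z S : Set E3}
    (hZ : IsCompact Z) (hZφ : Z ⊆ φ.target) (hS : S ⊆ Z)
    (hp : ∀ A, ContDiffOn ℝ ∞ (fun y => p A (φ.symm y)) φ.target)
    (hF : ∀ A i, ContDiffOn ℝ ∞ (fun y => frameMatrix X12 X13 X23 A i (φ.symm y)) φ.target)
    {δ η t₀ : ℝ} (hδ : 0 < δ) (hη : η ≤ δ)
    (hpδ : ∀ y ∈ S, ∀ A B, A < B → δ ≤ p B (φ.symm y) - p A (φ.symm y)) (l : ℕ)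
    (A B i j : Fin 3) :
    UnifCl (Set.Ioc 0 t₀) S l (fun t => t ^ η) (fun t y =>
      t ^ (2 * p (max i j) (φ.symm y) - 2 * p (max A B) (φ.symm y)) *
        (frameMatrix X12 X13 X23 A i (φ.symm y) * frameMatrix X12 X13 X23 B j (φ.symm y)) -
      if max i j = max A B then
        frameMatrix X12 X13 X23 A i (φ.symm y) * frameMatrix X12 X13 X23 B j (φ.symm y)
      else 0) := by
  rcases lt_trichotomy (max i j) (max A B) with h | h | h
  · simpa only [frameMatrix_mul_eq_zero X12 X13 X23 h, mul_zero, ite_self, sub_self]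
      using UnifCl.zero
  · simpa only [h, sub_self, Real.rpow_zero, one_mul, if_true] using UnifCl.zero
  · simp only [h.ne', if_false, sub_zero]
    -- The exponent is at least `2δ ≥ η + δ`; the extra `δ` is what `UnifCl.rpow` needs for the
    -- logarithms.
    have h1 := UnifCl.rpow (t₀ := t₀) (l := l) (η := η) (δ := δ) φ.open_target
      ((contDiffOn_const (c := (2 : ℝ))).mul (hp (max i j)) |>.sub
        ((contDiffOn_const (c := (2 : ℝ))).mul (hp (max A B)))) hZ hZφ hS hδ
      (fun y hy => by have := hpδ y hy _ _ h; linarith)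
    have h2 := UnifCl.static (T := Set.Ioc 0 t₀) (l := l) φ.open_target ((hF A i).mul (hF B j))
      hZ hZφ hS
    simpa only [mul_one] using h1.mul h2

theorem UnifCl.weaken_rpow {E : Type*} [NormedAddCommGroup E] [NormedSpace ℝ E] {S : Set E}
    {l : ℕ} {f : ℝ → E → ℝ} {t₀ η ε : ℝ} (hε : η ≤ ε)
    (hf : UnifCl (Set.Ioc 0 t₀) S l (fun t => t ^ ε) f) :
    UnifCl (Set.Ioc 0 t₀) S l (fun t => t ^ η) f := by
  refine hf.mono_weight (k := |t₀| ^ (ε - η)) (by positivity) fun t ht => ?_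
  have h1 : t ^ ε = t ^ (ε - η) * t ^ η := by rw [← Real.rpow_add ht.1]; congr 1; ring
  rw [h1]
  exact mul_le_mul_of_nonneg_right (Real.rpow_le_rpow ht.1.le
    (ht.2.trans (le_abs_self _)) (by linarith)) (Real.rpow_nonneg ht.1.le _)

theorem unifCl_frameCoeff_sub {p : Fin 3 → M → ℝ} {X12 X13 X23 : M → ℝ} {Z S : Set E3}
    (hZ : IsCompact Z) (hZφ : Z ⊆ φ.target) (hS : S ⊆ Z)
    (hp : ∀ A, ContDiffOn ℝ ∞ (fun y => p A (φ.symm y)) φ.target)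
    (hF : ∀ A i, ContDiffOn ℝ ∞ (fun y => frameMatrix X12 X13 X23 A i (φ.symm y)) φ.target)
    {δ η t₀ : ℝ} (hδ : 0 < δ) (hη0 : 0 ≤ η) (hη : η ≤ δ)
    (hpδ : ∀ y ∈ S, ∀ A B, A < B → δ ≤ p B (φ.symm y) - p A (φ.symm y)) {l : ℕ}
    {a : Fin 3 → Fin 3 → ℝ → M → ℝ} {c : Fin 3 → Fin 3 → M → ℝ}
    (hc : ∀ i j, ContDiffOn ℝ ∞ (fun y => c i j (φ.symm y)) φ.target)
    (ha : ∀ i j, UnifCl (Set.Ioc 0 t₀) S l (fun t => t ^ η)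
      (fun t y => a i j t (φ.symm y) - c i j (φ.symm y))) (A B : Fin 3) :
    UnifCl (Set.Ioc 0 t₀) S l (fun t => t ^ η) (fun t y =>
      frameCoeff p X12 X13 X23 a A B t (φ.symm y) - ∑ i, ∑ j, c i j (φ.symm y) *
        if max i j = max A B then
          frameMatrix X12 X13 X23 A i (φ.symm y) * frameMatrix X12 X13 X23 B j (φ.symm y)
        else 0) := by
  have he := unifCl_rpow_mul_frameMatrix_sub (t₀ := t₀) hZ hZφ hS hp hF hδ hη hpδ l A B
  have hs : ∀ {q : E3 → ℝ}, ContDiffOn ℝ ∞ q φ.target →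
      UnifCl (Set.Ioc 0 t₀) S l (fun _ => 1) (fun _ => q) := fun hq =>
    UnifCl.static φ.open_target hq hZ hZφ hS
  -- Weakening the rate to `t ^ 0` turns convergence of the factor of `aᵢⱼ` into boundedness.
  have he1 : ∀ i j, UnifCl (Set.Ioc 0 t₀) S l (fun _ => 1) (fun t y =>
      t ^ (2 * p (max i j) (φ.symm y) - 2 * p (max A B) (φ.symm y)) *
        (frameMatrix X12 X13 X23 A i (φ.symm y) * frameMatrix X12 X13 X23 B j (φ.symm y))) := by
    intro i j
    have h1 := ((he i j).weaken_rpow hη0)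
    simp only [Real.rpow_zero] at h1
    have h2 : ContDiffOn ℝ ∞ (fun y => if max i j = max A B then
        frameMatrix X12 X13 X23 A i (φ.symm y) * frameMatrix X12 X13 X23 B j (φ.symm y)
        else 0) φ.target := by
      split_ifs
      · exact (hF A i).mul (hF B j)
      · exact contDiffOn_const
    simpa only [sub_add_cancel] using h1.add (hs h2)
  -- With `u → v` the factor of `aᵢⱼ`, the error is split as `a u - c v = (a - c) u + c (u - v)`.
  have h3 := UnifCl.sum Finset.univ fun i _ => UnifCl.sum Finset.univ fun j _ =>
    UnifCl.add (by simpa only [mul_one] using (ha i j).mul (he1 i j))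
      (by simpa only [one_mul] using (hs (hc i j)).mul (he i j))
  refine h3.congr isOpen_univ (Set.subset_univ _) fun t _ y _ => ?_
  simp only [frameCoeff, ← Finset.sum_sub_distrib]
  exact Finset.sum_congr rfl fun i _ => Finset.sum_congr rfl fun j _ => by ring

/-- Convergence of the quotient `w / θ`, if `t w → k` and `t θ → 1` and `t θ` is bounded away from
zero. -/
theorem unifCl_div_sub {E : Type*} [NormedAddCommGroup E] [NormedSpace ℝ E] {T : Set ℝ}
    {S : Set E} {l : ℕ} {t₀ η : ℝ} (hT : T ⊆ Set.Ioc 0 t₀) (hη : 0 ≤ η) {f θ : ℝ → E → ℝ}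
    {k : E → ℝ} (hk : UnifCl (Set.Ioc 0 t₀) S l (fun _ => 1) (fun _ => k))
    (hf : UnifCl (Set.Ioc 0 t₀) S l (fun t => t ^ η) (fun t y => t * f t y - k y))
    (hθ : UnifCl (Set.Ioc 0 t₀) S l (fun t => t ^ η) (fun t y => t * θ t y - 1))
    {r : ℝ} (hr : 0 < r) (hrθ : ∀ t ∈ T, ∀ y ∈ S, r ≤ |t * θ t y|) :
    UnifCl T S l (fun t => t ^ η) (fun t y => f t y / θ t y - k y) := by
  have h1 : UnifCl (Set.Ioc 0 t₀) S l (fun _ => 1) (fun t y => t * θ t y) := by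
    have h2 := hθ.weaken_rpow hη
    simp only [Real.rpow_zero] at h2
    have h3 : UnifCl (Set.Ioc 0 t₀) S l (fun _ => 1) (fun _ (_ : E) => (1 : ℝ)) :=
      ⟨fun _ _ _ _ => contDiffAt_const, 1, zero_le_one, fun t _ y _ m _ => by
        rcases Nat.eq_zero_or_pos m with rfl | hm
        · simp
        · simp [iteratedFDeriv_const_of_ne hm.ne']⟩
    simpa only [sub_add_cancel] using h2.add h3
  have hinv := (h1.mono_set hT).inv hr hrθ
  -- `f/θ - k = ((t f - k) - (t θ - 1) k) (t θ)⁻¹`; the first factor is `O(t ^ η)` and the second is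
  -- bounded.
  have hnum := (hf.sub (by simpa only [mul_one] using hθ.mul hk)).mono_set hT
  have hq := hnum.mul hinv
  simp only [mul_one] at hq
  refine hq.congr_eventuallyEq fun t ht y hy => ?_
  have hne : t * θ t y ≠ 0 := fun h0 => by
    have := hrθ t ht y hy
    rw [h0, abs_zero] at this
    exact hr.not_ge this
  -- The lower bound on `t θ` is known only on `S`, so continuity supplies a neighbourhood where `θ
  -- ≠ 0`.
  filter_upwards [(h1.smooth t (hT ht) y hy).continuousAt.eventually_ne hne] with z hz
  have ht0 : t ≠ 0 := left_ne_zero_of_mul hz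
  have hθ0 : θ t z ≠ 0 := right_ne_zero_of_mul hz
  field_simp
  ring

theorem exists_mem_Ioc_mul_rpow_le {t₀ η C : ℝ} (ht₀ : 0 < t₀) (hη : 0 < η) (hC : 0 ≤ C) :
    ∃ t₁ ∈ Set.Ioc 0 t₀, ∀ t ∈ Set.Ioc 0 t₁, C * t ^ η ≤ 1 / 2 := by
  -- `C + 1` replaces `C` so that the quotient makes sense for `C = 0`.
  have hpos : 0 < (1 / (2 * (C + 1))) ^ (1 / η) := by positivity
  refine ⟨min t₀ ((1 / (2 * (C + 1))) ^ (1 / η)), ⟨lt_min ht₀ hpos, min_le_left _ _⟩,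
    fun t ht => ?_⟩
  have h1 : t ^ η ≤ 1 / (2 * (C + 1)) := by
    have h2 := Real.rpow_le_rpow ht.1.le (ht.2.trans (min_le_right _ _)) hη.le
    rwa [← Real.rpow_mul (by positivity), one_div_mul_cancel hη.ne', Real.rpow_one] at h2
  calc C * t ^ η ≤ C * (1 / (2 * (C + 1))) := by gcongr
    _ ≤ 1 / 2 := by
      rw [mul_one_div, div_le_div_iff₀ (by positivity) (by norm_num)]
      linarith

end Convergence

end BigBang

open BigBang

/-! ### The theorem -/

theorem mainTheorem12
    {M : Type*} [TopologicalSpace M] [T2Space M] [SecondCountableTopology M]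
    [ChartedSpace E3 M] [IsManifold (𝓡 3) ∞ M]
    -- the Riemannian metric `h` and the `(1,1)`-tensor field `K`, symmetric with respect to `h`
    (h : Bundle.ContMDiffRiemannianMetric (𝓡 3) ∞ E3 (fun x : M => TangentSpace (𝓡 3) x))
    (K : ∀ x : M, TangentSpace (𝓡 3) x →L[ℝ] TangentSpace (𝓡 3) x)
    (hKsmooth : ContMDiff (𝓡 3) ((𝓡 3).prod 𝓘(ℝ, E3 →L[ℝ] E3)) ∞
      (fun x : M => Bundle.TotalSpace.mk' (E3 →L[ℝ] E3)
        (E := fun x : M => TangentSpace (𝓡 3) x →L[ℝ] TangentSpace (𝓡 3) x) x (K x)))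
    (hKsymm : ∀ (x : M) (v w : TangentSpace (𝓡 3) x),
      h.inner x (K x v) w = h.inner x v (K x w))
    -- the distinct eigenvalues `p₁ < p₂ < p₃` of `K`
    (p : Fin 3 → M → ℝ) (hp : ∀ x, StrictMono fun A => p A x)
    (hpeig : ∀ A x, Module.End.HasEigenvalue (K x).toLinearMap (p A x))
    -- the coordinates on `V = φ.source` and the triangular eigenframe
    (φ : OpenPartialHomeomorph M E3) (hφ : φ ∈ IsManifold.maximalAtlas (𝓡 3) ∞ M)
    (hKtrace : ∀ x ∈ φ.source,
      LinearMap.trace ℝ (TangentSpace (𝓡 3) x) (K x).toLinearMap = 1)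
    (X12 X13 X23 : M → ℝ)
    (hX12 : ContMDiffOn (𝓡 3) 𝓘(ℝ, ℝ) ∞ X12 φ.source)
    (hX13 : ContMDiffOn (𝓡 3) 𝓘(ℝ, ℝ) ∞ X13 φ.source)
    (hX23 : ContMDiffOn (𝓡 3) 𝓘(ℝ, ℝ) ∞ X23 φ.source)
    (hX : ∀ A, ∀ x ∈ φ.source,
      K x (triFrame φ X12 X13 X23 A x) = p A x • triFrame φ X12 X13 X23 A x)
    -- the functions `cᵢⱼ` and `κᵢʲ`
    (c : Fin 3 → Fin 3 → M → ℝ)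
    (hc : c = limitC φ (fun x v w => h.inner x v w) K p X12 X13 X23)
    (κ : Fin 3 → Fin 3 → M → ℝ) (hκ : κ = kappa p c)
    -- the vacuum solution on `V × (0, t₀]`, and its induced metrics on the leaves
    (t₀ : ℝ) (ht₀ : 0 < t₀) (a : Fin 3 → Fin 3 → ℝ → M → ℝ)
    (hsol : IsVacuumSolution φ p a t₀)
    (gbar : ℝ → ∀ x : M, TangentSpace (𝓡 3) x → TangentSpace (𝓡 3) x → ℝ)
    (hgbar : gbar = inducedMetric (gaussMetric (coordForm φ) p a))
    -- the set on which convergence is considered, and the rate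
    (W : Set M) (hWc : IsCompact (closure W)) (hWV : closure W ⊆ φ.source)
    (ε : ℝ) (hε : 0 < ε) :
    ∃ b : Fin 3 → Fin 3 → ℝ → M → ℝ,
      -- the geometric form of the metric
      (∀ A B, ContMDiffOn ((𝓡 3).prod 𝓘(ℝ, ℝ)) 𝓘(ℝ, ℝ) ∞
        (fun q : M × ℝ => b A B q.2 q.1) (φ.source ×ˢ Set.Ioc 0 t₀)) ∧
      (∀ A B, ∀ t ∈ Set.Ioc 0 t₀, ∀ x ∈ φ.source, b A B t x = b B A t x) ∧
      (∀ t ∈ Set.Ioc 0 t₀, ∀ x ∈ φ.source, ∀ u w : TangentSpace (𝓡 3) x × ℝ,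
        gaussMetric (coordForm φ) p a t x u w =
          gaussMetric (triCoframe φ X12 X13 X23) p b t x u w) ∧
      -- the convergence
      ∃ η : ℝ, 0 < η ∧ ∀ l : ℕ,
        (∃ C : ℝ, ∀ i j, ∀ t ∈ Set.Ioc 0 t₀,
          clNorm φ l W (fun x => a i j t x - c i j x) ≤ ENNReal.ofReal (C * t ^ ε) ∧
          clNorm φ l W (fun x => t * weingarten φ (Set.Ioc 0 t₀) gbar i j t x + κ i j x) ≤
            ENNReal.ofReal (C * t ^ ε)) →
        -- convergence of `ȟ` to `h`
        (∃ C : ℝ, ∀ t ∈ Set.Ioc 0 t₀,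
          clTensorNorm φ l W (fun i j x =>
            comp02 φ (hCheck (triCoframe φ X12 X13 X23) b t) i j x
              - comp02 φ (fun x v w => h.inner x v w) i j x) ≤
            ENNReal.ofReal (C * t ^ η)) ∧
        -- positivity of the mean curvature and convergence of `𝒦` near the singularity
        (∃ t₁ ∈ Set.Ioc 0 t₀,
          (∀ t ∈ Set.Ioc 0 t₁, ∀ x ∈ W, 0 < meanCurvature φ (Set.Ioc 0 t₀) gbar t x) ∧
          ∃ C : ℝ, ∀ t ∈ Set.Ioc 0 t₁,
            clTensorNorm φ l W (fun i j x =>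
              expNormWeingarten φ (Set.Ioc 0 t₀) gbar i j t x - comp11 φ K i j x) ≤
              ENNReal.ofReal (C * t ^ η)) ∧
        -- convergence of `𝒦` on all of `(0, t₀]` if `𝒦` is defined there
        ((∀ t ∈ Set.Ioc 0 t₀, ∀ x ∈ closure W,
            meanCurvature φ (Set.Ioc 0 t₀) gbar t x ≠ 0) →
          ∃ C : ℝ, ∀ t ∈ Set.Ioc 0 t₀,
            clTensorNorm φ l W (fun i j x =>
              expNormWeingarten φ (Set.Ioc 0 t₀) gbar i j t x - comp11 φ K i j x) ≤
              ENNReal.ofReal (C * t ^ η)) := by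
  have hpK : ∀ A, ∀ x ∈ φ.source, p A x = comp11 φ K A A x := fun A x hx => by
    rw [comp11_eq hφ hx fun A => hX A x hx]
    fin_cases A <;> rfl
  have hps : ∀ A, ContMDiffOn (𝓡 3) 𝓘(ℝ, ℝ) ∞ (p A) φ.source := fun A =>
    (contMDiffOn_comp11 hφ hKsmooth A A).congr (hpK A)
  refine ⟨frameCoeff p X12 X13 X23 a, contMDiffOn_frameCoeff hps hX12 hX13 hX23 hsol.smooth,
    fun A B t ht x hx => frameCoeff_comm (fun i j => hsol.symm i j t ht x hx) A B,
    fun t ht x _ u w => gaussMetric_coordForm_eq ht.1 u w, ?_⟩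
  obtain ⟨δ, hδ, hpδ⟩ := exists_pos_le_sub_of_isCompact hWc hp
    fun A => (hps A).continuousOn.mono hWV
  -- Only `ε` and the eigenvalue gap enter, so the rate is fixed before `l`.
  set η : ℝ := min ε δ with hηdef
  have hη : 0 < η := lt_min hε hδ
  refine ⟨η, hη, fun l ⟨C, hC⟩ => ?_⟩
  have hW : W ⊆ φ.source := subset_closure.trans hWV
  set Z : Set E3 := φ '' closure W with hZdef
  set S : Set E3 := φ '' W with hSdef
  have hZ : IsCompact Z := hWc.image_of_continuousOn (φ.continuousOn.mono hWV)
  have hZφ : Z ⊆ φ.target := fun y ⟨x, hx, hxy⟩ => hxy ▸ φ.map_source (hWV hx)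
  have hS : S ⊆ Z := Set.image_mono subset_closure
  have hSφ : S ⊆ φ.target := hS.trans hZφ
  have hsymm : ∀ x ∈ W, φ.symm (φ x) = x := fun x hx => φ.left_inv (hW hx)
  have hT0 : ∀ (e : ℝ), ∀ t ∈ Set.Ioc 0 t₀, 0 ≤ t ^ e := fun e t ht => Real.rpow_nonneg ht.1.le e
  have hstat : ∀ {q : M → ℝ}, ContMDiffOn (𝓡 3) 𝓘(ℝ, ℝ) ∞ q φ.source →
      UnifCl (Set.Ioc 0 t₀) S l (fun _ => 1) (fun _ y => q (φ.symm y)) := fun hq =>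
    UnifCl.static φ.open_target (contDiffOn_comp_symm hφ hq) hZ hZφ hS
  have hslice : ∀ {F : ℝ × E3 → ℝ}, ContDiffOn ℝ ∞ F (Set.Ioc 0 t₀ ×ˢ φ.target) →
      ∀ t ∈ Set.Ioc 0 t₀, ContDiffOn ℝ ∞ (fun y => F (t, y)) φ.target := fun hF t ht =>
    hF.comp (contDiff_prodMk_right t).contDiffOn fun y hy => ⟨ht, hy⟩
  -- the coefficients of the metric
  have hcs : ∀ i j, ContMDiffOn (𝓡 3) 𝓘(ℝ, ℝ) ∞ (c i j) φ.source := fun i j => by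
    rw [hc]
    exact contMDiffOn_limitC hφ h hp hX12 hX13 hX23 hX i j
  have hcs' : ∀ i j, ContDiffOn ℝ ∞ (fun y => c i j (φ.symm y)) φ.target := fun i j =>
    contDiffOn_comp_symm hφ (hcs i j)
  have ha : ∀ i j, UnifCl (Set.Ioc 0 t₀) S l (fun t => t ^ η)
      (fun t y => a i j t (φ.symm y) - c i j (φ.symm y)) := fun i j =>
    (unifCl_of_clNorm_le (f := fun t x => a i j t x - c i j x) hW (hT0 ε)
      (fun t ht => (hslice (contDiffOn_prod_symm hφ (hsol.smooth i j)) t ht).sub (hcs' i j))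
      fun t ht => (hC i j t ht).1).weaken_rpow (min_le_left _ _)
  have hb := unifCl_frameCoeff_sub hZ hZφ hS (fun A => contDiffOn_comp_symm hφ (hps A))
    (fun A i => contDiffOn_comp_symm hφ (contMDiffOn_frameMatrix hX12 hX13 hX23 A i))
    hδ hη.le (min_le_right _ _) (by
      rintro y ⟨x, hx, rfl⟩ A B hAB
      rw [hsymm x hx]
      exact hpδ x (subset_closure hx) A B hAB) hcs' ha
  refine ⟨clTensorNorm_le_of_unifCl (f := fun i j t x =>
    comp02 φ (hCheck (triCoframe φ X12 X13 X23) (frameCoeff p X12 X13 X23 a) t) i j x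
      - comp02 φ (fun x v w => h.inner x v w) i j x) (hT0 η) fun i j => ?_, ?_⟩
  -- The components of `ȟ - h` are the errors in `b_AB` contracted with the time-independent
  -- coefficients of the coframe.
  · have h1 := UnifCl.sum Finset.univ fun A _ => UnifCl.sum Finset.univ fun B _ =>
      (hb A B).mul (hstat ((contMDiffOn_coframeMatrix hX12 hX13 hX23 A i).mul
        (contMDiffOn_coframeMatrix hX12 hX13 hX23 B j)))
    simp only [mul_one] at h1
    refine h1.congr φ.open_target hSφ fun t _ y hy => ?_
    have hy' := φ.map_target hy
    rw [comp02_eq_sum hφ hy' h (hKsymm _) (hp _) fun A => hX A _ hy']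
    simp only [comp02, hCheck, triCoframe_coordVF hφ hy', ← Finset.sum_sub_distrib]
    refine Finset.sum_congr rfl fun A _ => Finset.sum_congr rfl fun B _ => ?_
    rw [hc, sum_limitC_frameMatrix hφ hy' _ (hp _) fun A => hX A _ hy']
    simp only [Pi.mul_apply]
    ring
  -- the Weingarten map
  have hwsm : ∀ i j, ContDiffOn ℝ ∞ (fun q : ℝ × E3 =>
      weingarten φ (Set.Ioc 0 t₀) gbar i j q.1 (φ.symm q.2)) (Set.Ioc 0 t₀ ×ˢ φ.target) :=
    fun i j => by
      rw [hgbar]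
      exact contDiffOn_weingarten hφ hps hsol i j
  have hKs := contMDiffOn_comp11 hφ hKsmooth
  have hκK : ∀ i j, ∀ x ∈ φ.source, κ i j x = -comp11 φ K i j x := fun i j x hx => by
    rw [hκ, hc]
    exact kappa_limitC_eq hφ hx _ (fun v hv => h.pos x v hv) (hp x) (fun A => hX A x hx) i j
  have hKsum : ∀ x ∈ φ.source, ∑ i, comp11 φ K i i x = 1 := fun x hx => by
    rw [← hKtrace x hx, trace_eq_sum_of_triFrame hφ hx fun A => hX A x hx]
    exact Finset.sum_congr rfl fun A _ => (hpK A x hx).symm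
  have hw : ∀ i j, UnifCl (Set.Ioc 0 t₀) S l (fun t => t ^ η) (fun t y =>
      t * weingarten φ (Set.Ioc 0 t₀) gbar i j t (φ.symm y) - comp11 φ K i j (φ.symm y)) := by
    intro i j
    have h1 : UnifCl (Set.Ioc 0 t₀) S l (fun t => t ^ ε) (fun t y =>
        t * weingarten φ (Set.Ioc 0 t₀) gbar i j t (φ.symm y) + κ i j (φ.symm y)) :=
      unifCl_of_clNorm_le
        (f := fun t x => t * weingarten φ (Set.Ioc 0 t₀) gbar i j t x + κ i j x) hW (hT0 ε)
        (fun t ht => (contDiffOn_const.mul (hslice (hwsm i j) t ht)).add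
          (contDiffOn_comp_symm hφ ((hKs i j).neg.congr (hκK i j))))
        fun t ht => (hC i j t ht).2
    refine (h1.weaken_rpow (min_le_left _ _)).congr φ.open_target hSφ fun t _ y hy => ?_
    rw [hκK i j _ (φ.map_target hy), sub_eq_add_neg]
  -- This is the trace of `hw`, as `tr 𝒦 = 1`.
  have hθ : UnifCl (Set.Ioc 0 t₀) S l (fun t => t ^ η) (fun t y =>
      t * meanCurvature φ (Set.Ioc 0 t₀) gbar t (φ.symm y) - 1) := by
    refine (UnifCl.sum Finset.univ fun i _ => hw i i).congr φ.open_target hSφ fun t _ y hy => ?_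
    rw [Finset.sum_sub_distrib, hKsum _ (φ.map_target hy), ← Finset.mul_sum, meanCurvature]
  -- Both convergence claims for `𝒦` reduce to a positive lower bound for `|t θ|` on the time set in
  -- question.
  have hconv : ∀ T ⊆ Set.Ioc 0 t₀, ∀ r, 0 < r →
      (∀ t ∈ T, ∀ x ∈ W, r ≤ |t * meanCurvature φ (Set.Ioc 0 t₀) gbar t x|) →
      ∃ C : ℝ, ∀ t ∈ T, clTensorNorm φ l W (fun i j x =>
        expNormWeingarten φ (Set.Ioc 0 t₀) gbar i j t x - comp11 φ K i j x) ≤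
          ENNReal.ofReal (C * t ^ η) := by
    intro T hT r hr hrθ
    refine clTensorNorm_le_of_unifCl (f := fun i j t x =>
      expNormWeingarten φ (Set.Ioc 0 t₀) gbar i j t x - comp11 φ K i j x)
      (fun t ht => hT0 η t (hT ht)) fun i j => ?_
    refine unifCl_div_sub (f := fun t y => weingarten φ (Set.Ioc 0 t₀) gbar i j t (φ.symm y))
      (θ := fun t y => meanCurvature φ (Set.Ioc 0 t₀) gbar t (φ.symm y)) hT hη.le
      (hstat (hKs i j)) (hw i j) hθ hr ?_
    rintro t ht y ⟨x, hx, rfl⟩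
    rw [hsymm x hx]
    exact hrθ t ht x hx
  obtain ⟨D, hD, hDθ⟩ := hθ.exists_abs_le
  -- Up to `t₁` the error `|t θ - 1|` is at most `1/2`, so `t θ ≥ 1/2`.
  obtain ⟨t₁, ht₁, hDt⟩ := exists_mem_Ioc_mul_rpow_le ht₀ hη hD
  have hT₁ : Set.Ioc 0 t₁ ⊆ Set.Ioc 0 t₀ := Set.Ioc_subset_Ioc_right ht₁.2
  have hhalf : ∀ t ∈ Set.Ioc 0 t₁, ∀ x ∈ W,
      1 / 2 ≤ t * meanCurvature φ (Set.Ioc 0 t₀) gbar t x := fun t ht x hx => by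
    have h1 := (hDθ t (hT₁ ht) (φ x) ⟨x, hx, rfl⟩).trans (hDt t ht)
    rw [hsymm x hx] at h1
    linarith [(abs_le.1 h1).1]
  refine ⟨⟨t₁, ht₁, fun t ht x hx => ?_, hconv _ hT₁ (1 / 2) (by norm_num)
    fun t ht x hx => (hhalf t ht x hx).trans (le_abs_self _)⟩, fun hne => ?_⟩
  · exact pos_of_mul_pos_right (lt_of_lt_of_le (by norm_num) (hhalf t ht x hx)) ht.1.le
  -- away from the singularity, `θ` is bounded away from zero by compactness
  have hcompact : IsCompact (Set.Icc t₁ t₀ ×ˢ Z) := isCompact_Icc.prod hZ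
  have hsub : Set.Icc t₁ t₀ ×ˢ Z ⊆ Set.Ioc 0 t₀ ×ˢ φ.target :=
    Set.prod_mono (fun t ht => ⟨ht₁.1.trans_le ht.1, ht.2⟩) hZφ
  have hcont : ContinuousOn (fun q : ℝ × E3 =>
      |q.1 * meanCurvature φ (Set.Ioc 0 t₀) gbar q.1 (φ.symm q.2)|) (Set.Icc t₁ t₀ ×ˢ Z) := by
    refine (ContinuousOn.mul continuousOn_fst ?_).abs
    simp only [meanCurvature]
    exact continuousOn_finsetSum _ fun i _ => (hwsm i i).continuousOn.mono hsub
  obtain ⟨r, hr, hrθ⟩ := hcompact.exists_forall_le' hcont (a := 0) (by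
    rintro ⟨t, y⟩ ⟨ht, ⟨x, hx, rfl⟩⟩
    have ht' : 0 < t := ht₁.1.trans_le ht.1
    rw [φ.left_inv (hWV hx)]
    exact abs_pos.2 (mul_ne_zero ht'.ne' (hne t ⟨ht', ht.2⟩ x hx)))
  -- The bound `1/2` serves up to `t₁`, the compactness bound `r` from `t₁` on.
  refine hconv _ subset_rfl (min (1 / 2) r) (lt_min (by norm_num) hr) fun t ht x hx => ?_
  rcases le_total t t₁ with h1 | h1
  · exact (min_le_left _ _).trans ((hhalf t ⟨ht.1, h1⟩ x hx).trans (le_abs_self _))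
  · have h2 := hrθ (t, φ x) ⟨⟨h1, ht.2⟩, ⟨x, subset_closure hx, rfl⟩⟩
    simp only [hsymm x hx] at h2
    exact (min_le_right _ _).trans h2
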